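/- Let $\Bbbk$ be a field of characteristic zero and let $C^*([0,1])=C^0\oplus C^1\subset \Bbbk[t]\oplus\Bbbk[t]\,dt$ be the complex of Whitney forms, $C^0=\{at+b(1-t)\mid a,b\in\Bbbk\}$, $C^1=\{c\,dt\mid c\in\Bbbk\}$, with the de Rham differential $d$. Write $\mathbf{s}$ for the suspension, $(\mathbf{s}V)^i=V^{i+1}$, and equip the reduced tensor coalgebra $\overline{T}(\mathbf{s}C^*([0,1]))=\bigoplus_{n\ge1}(\mathbf{s}C^*([0,1]))^{\otimes n}$ with the deconcatenation coproduct and the graded shuffle product. Let $C^*_\infty([0,1])$ be the unital $C_\infty$ algebra given by the coderivation $M$ of $\overline{T}(\mathbf{s}C^*([0,1]))$ of degree one whose Taylor coefficients $m_n:(\mathbf{s}C^*([0,1]))^{\otimes n}\to\mathbf{s}C^*([0,1])$ are as follows: - $m_1(\mathbf{s}x)=-\mathbf{s}\,dx$; - $m_2(\mathbf{s}1\otimes\mathbf{s}x)=\mathbf{s}x$, $m_2(\mathbf{s}x\otimes\mathbf{s}1)=(-1)^{|x|}\mathbf{s}x$, and $m_n$ vanishes for $n\ge3$ whenever one argument is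 $\mathbf{s}1$; - $m_2(\mathbf{s}t\otimes\mathbf{s}t)=\mathbf{s}t$; - $m_{n+1}\big((\mathbf{s}dt)^{\otimes i}\otimes\mathbf{s}t\otimes(\mathbf{s}dt)^{\otimes n-i}\big)=(-1)^{i+1}\binom{n}{i}\frac{B_n}{n!}\,\mathbf{s}dt$ for $n\ge1$, $0\le i\le n$, where $\sum_{n\ge0}B_n\frac{z^n}{n!}=\frac{z}{e^z-1}$; - $m_n$, $n\ge2$, vanishes on all other tensor products of the elements $\mathbf{s}1,\mathbf{s}t,\mathbf{s}dt$. A unital $C_\infty$ endomorphism of $C^*_\infty([0,1])$ is a linear map $\psi$ of degree zero from $\overline{T}(\mathbf{s}C^*([0,1]))$ to itself that is compatible with the coproduct, with the shuffle product and with $M$, and whose Taylor coefficients $\psi_n:(\mathbf{s}C^*([0,1]))^{\otimes n}\to\mathbf{s}C^*([0,1])$ satisfy $\psi_1(\mathbf{s}1)=\mathbf{s}1$ and $\psi_n(\cdots\otimes\mathbf{s}1\otimes\cdots)=0$ for $n\ge2$. Let $\mathsf{Aut}_\infty(C^*_\infty([0,1]))$ be the group of invertible elements of the monoid of these endomorphisms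 under composition, and let $\mathrm{GL}(C^*([0,1]))$ be the group of those automorphisms of the complex $C^*([0,1])$ that map $1$ to itself. Then $\psi\mapsto\psi_1$ (regarded as a map from $C^*([0,1])$ to itself) is a well-defined isomorphism of groups $$r:\mathsf{Aut}_\infty(C^*_\infty([0,1]))\to\mathrm{GL}(C^*([0,1])).$$ Moreover $\mathrm{GL}(C^*([0,1]))\cong\mathsf{Aff}(\Bbbk)\cong\Bbbk^*\ltimes\Bbbk$, where $\mathsf{Aff}(\Bbbk)$ is the group of affine bijections of $\Bbbk$: there is an isomorphism of groups sending $\xi\in\mathrm{GL}(C^*([0,1]))$ to an affine bijection $A_\xi$ with $\xi(f)=f\circ A_\xi^{-1}$ for all $f\in C^0$, and an isomorphism of groups sending the affine bijection $x\mapsto\alpha x+\beta$ to $(\alpha,\beta)\in\Bbbk^*\ltimes\Bbbk$, where $\Bbbk^*$ acts on $\Bbbk$ by multiplication. -/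

import Mathlib

open Polynomial
open scoped TensorProduct

noncomputable section

/-! ### Polynomial differential forms on the interval and Whitney forms -/

namespace Whitney

/-- Polynomial differential forms on `[0,1]`: the pair `(f, a)` is the form `f + a dt`. -/
abbrev PolyForm (k : Type*) [Field k] : Type _ := k[X] × k[X]

/-- The de Rham differential `f + a dt ↦ f' dt`. -/
def polyD (k : Type*) [Field k] : PolyForm k →ₗ[k] PolyForm k :=
  (LinearMap.inr k k[X] k[X]).comp (Polynomial.derivative.comp (LinearMap.fst k k[X] k[X]))

/-- The Whitney forms `{a t + b (1 - t)} ⊕ {c dt}` inside the polynomial forms. -/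
def forms (k : Type*) [Field k] : Submodule k (PolyForm k) :=
  (Submodule.span k {(X : k[X]), 1 - X}).prod (Submodule.span k {(1 : k[X])})

/-- Whitney forms of degree zero. -/
def forms0 (k : Type*) [Field k] : Submodule k (forms k) :=
  LinearMap.ker ((LinearMap.snd k k[X] k[X]).comp (forms k).subtype)

/-- Whitney forms of degree one. -/
def forms1 (k : Type*) [Field k] : Submodule k (forms k) :=
  LinearMap.ker ((LinearMap.fst k k[X] k[X]).comp (forms k).subtype)

lemma polyD_mem {k : Type*} [Field k] (x : PolyForm k) (hx : x ∈ forms k) :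
    polyD k x ∈ forms k := by
  obtain ⟨h1, -⟩ := Submodule.mem_prod.1 hx
  obtain ⟨a, b, hab⟩ := Submodule.mem_span_pair.1 h1
  refine Submodule.mem_prod.2 ⟨Submodule.zero_mem _, ?_⟩
  refine Submodule.mem_span_singleton.2 ⟨a - b, ?_⟩
  simp [polyD, ← hab, sub_eq_add_neg, add_smul]

/-- The differential of the complex of Whitney forms. -/
def d (k : Type*) [Field k] : forms k →ₗ[k] forms k :=
  (polyD k).restrict polyD_mem

/-- Labels of the homogeneous basis `1, t, dt` of the Whitney forms. -/
inductive Letter : Type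
  | one
  | t
  | dt
  deriving DecidableEq

/-- The polynomial form named by a letter. -/
def letterForm (k : Type*) [Field k] : Letter → PolyForm k
  | .one => (1, 0)
  | .t => (X, 0)
  | .dt => (0, 1)

lemma letterForm_mem (k : Type*) [Field k] (j : Letter) : letterForm k j ∈ forms k := by
  cases j
  · exact Submodule.mem_prod.2
      ⟨Submodule.mem_span_pair.2 ⟨1, 1, by simp [letterForm]⟩, Submodule.zero_mem _⟩
  · exact Submodule.mem_prod.2
      ⟨Submodule.mem_span_pair.2 ⟨1, 0, by simp [letterForm]⟩, Submodule.zero_mem _⟩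
  · exact Submodule.mem_prod.2
      ⟨Submodule.zero_mem _, Submodule.mem_span_singleton.2 ⟨1, by simp [letterForm]⟩⟩

/-- The elements `1, t, dt` of the space of Whitney forms. -/
def letter (k : Type*) [Field k] (j : Letter) : forms k := ⟨letterForm k j, letterForm_mem k j⟩

instance : Fintype Letter := ⟨{.one, .t, .dt}, fun j => by cases j <;> simp⟩

lemma sum_letter {M : Type*} [AddCommMonoid M] (f : Letter → M) :
    ∑ j, f j = f .one + (f .t + f .dt) := by
  change ∑ j ∈ {Letter.one, Letter.t, Letter.dt}, f j = _
  simp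

lemma letter_linearIndependent (k : Type*) [Field k] : LinearIndependent k (letter k) := by
  rw [Fintype.linearIndependent_iff]
  intro g hg
  rw [sum_letter] at hg
  have h := congrArg Subtype.val hg
  simp only [letter, letterForm, Submodule.coe_add, Submodule.coe_smul, Submodule.coe_zero] at h
  have h1 := congrArg Prod.fst h
  have h2 := congrArg Prod.snd h
  have a0 := congrArg (fun p : k[X] => p.coeff 0) h1
  have a1 := congrArg (fun p : k[X] => p.coeff 1) h1
  have a2 := congrArg (fun p : k[X] => p.coeff 0) h2
  simp [coeff_one] at a0 a1 a2
  intro j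
  cases j
  · exact a0
  · exact a1
  · exact a2

lemma letter_span (k : Type*) [Field k] : ⊤ ≤ Submodule.span k (Set.range (letter k)) := by
  rintro ⟨⟨f, a⟩, hx⟩ -
  obtain ⟨h1, h2⟩ := Submodule.mem_prod.1 hx
  obtain ⟨p, q, hpq⟩ := Submodule.mem_span_pair.1 h1
  obtain ⟨c, hc⟩ := Submodule.mem_span_singleton.1 h2
  have key : (⟨(f, a), hx⟩ : forms k)
      = q • letter k .one + (p - q) • letter k .t + c • letter k .dt := by
    apply Subtype.ext
    simp only at hpq hc
    simp only [letter, letterForm, Submodule.coe_add, Submodule.coe_smul, Prod.smul_mk,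
      Prod.mk_add_mk, smul_zero, add_zero, zero_add, ← hpq, hc, Prod.mk.injEq, and_true]
    rw [smul_sub, sub_smul]
    abel
  rw [key]
  have hm (j : Letter) : letter k j ∈ Submodule.span k (Set.range (letter k)) :=
    Submodule.subset_span ⟨j, rfl⟩
  exact Submodule.add_mem _ (Submodule.add_mem _ (Submodule.smul_mem _ _ (hm _))
    (Submodule.smul_mem _ _ (hm _))) (Submodule.smul_mem _ _ (hm _))

/-- The homogeneous basis `1, t, dt` of the space of Whitney forms. -/
def basis (k : Type*) [Field k] : Module.Basis Letter k (forms k) :=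
  Module.Basis.mk (letter_linearIndependent k) (letter_span k)

/-- The monoid of endomorphisms of the cochain complex of Whitney forms that fix `1`. -/
def chainEnd (k : Type*) [Field k] : Submonoid (Module.End k (forms k)) where
  carrier := {ξ | (∀ x ∈ forms0 k, ξ x ∈ forms0 k) ∧ (∀ x ∈ forms1 k, ξ x ∈ forms1 k) ∧
    (∀ x, d k (ξ x) = ξ (d k x)) ∧ ξ (letter k .one) = letter k .one}
  one_mem' := ⟨fun _ h => h, fun _ h => h, fun _ => rfl, rfl⟩
  mul_mem' := by
    rintro ξ η ⟨a1, a2, a3, a4⟩ ⟨b1, b2, b3, b4⟩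
    refine ⟨fun x hx => a1 _ (b1 x hx), fun x hx => a2 _ (b2 x hx), fun x => ?_, ?_⟩
    · simp only [Module.End.mul_apply, a3, b3]
    · simp only [Module.End.mul_apply, a4, b4]

/-- The group of automorphisms of the complex of Whitney forms that map `1` to itself. -/
abbrev ChainAut (k : Type*) [Field k] : Type _ := (chainEnd k)ˣ

end Whitney

/-! ### The reduced tensor coalgebra on a graded vector space with homogeneous basis `ι`

Throughout, `V = ι →₀ k` is the graded vector space with basis `ι`, and `deg : ι → ℤ` gives the
degrees of the basis elements (in applications `V` is the suspension of the space of interest, and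
`deg` is the degree after suspension). -/

namespace TBar

/-- The reduced tensor coalgebra `⨁ n ≥ 1, V ⊗ ⋯ ⊗ V`, with its basis of nonempty words
`x₁ ⊗ ⋯ ⊗ xₙ` in the basis elements of `V`. -/
abbrev T (k ι : Type*) [Field k] : Type _ := {w : List ι // w ≠ []} →₀ k

/-- The basis element of the reduced tensor coalgebra given by a word, and zero for the empty
word. -/
def word (k : Type*) [Field k] {ι : Type*} (w : List ι) : T k ι := by
  classical exact if h : w ≠ [] then Finsupp.single ⟨w, h⟩ 1 else 0

/-- The total degree of a word. -/
def wdeg {ι : Type*} (deg : ι → ℤ) (w : List ι) : ℤ := (w.map deg).sum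

/-- The Koszul sign `(-1)^n`. -/
def sgn (k : Type*) [Field k] (n : ℤ) : k := ((Int.negOnePow n : ℤˣ) : ℤ)

/-- The linear map with prescribed values on the basis of words. -/
def lift {k ι M : Type*} [Field k] [AddCommGroup M] [Module k M] (f : List ι → M) :
    T k ι →ₗ[k] M :=
  Finsupp.linearCombination k (fun w : {w : List ι // w ≠ []} => f w.1)

/-- The deconcatenation coproduct `x₁ ⊗ ⋯ ⊗ xₙ ↦ ∑_{0 < i < n} (x₁ ⊗ ⋯ ⊗ xᵢ) ⊗ (xᵢ₊₁ ⊗ ⋯ ⊗ xₙ)`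
(the term with `i = 0` in the sum vanishes, since `word k [] = 0`). -/
def comul (k ι : Type*) [Field k] : T k ι →ₗ[k] T k ι ⊗[k] T k ι :=
  lift (fun w => ∑ i ∈ Finset.range w.length, word k (w.take i) ⊗ₜ[k] word k (w.drop i))

/-- The projection onto the tensors of length one, `V` itself. -/
def proj (k ι : Type*) [Field k] : T k ι →ₗ[k] (ι →₀ k) :=
  lift (fun w => match w with
    | [j] => Finsupp.single j 1
    | _ => 0)

/-- The inclusion of `V` as the tensors of length one. -/
def incl (k ι : Type*) [Field k] : (ι →₀ k) →ₗ[k] T k ι :=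
  Finsupp.linearCombination k (fun j => word k [j])

/-- Left tensoring with a basis element. -/
def cons (k : Type*) [Field k] {ι : Type*} (j : ι) : T k ι →ₗ[k] T k ι :=
  lift (fun w => word k (j :: w))

/-- The signed sum of all shuffles of two words. -/
def shuffleWord (k : Type*) [Field k] {ι : Type*} (deg : ι → ℤ) : List ι → List ι → T k ι
  | [], v => word k v
  | u, [] => word k u
  | a :: u, b :: v =>
      cons k a (shuffleWord k deg u (b :: v)) +
        sgn k (deg b * wdeg deg (a :: u)) • cons k b (shuffleWord k deg (a :: u) v)
  termination_by u v => u.length + v.length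

/-- The graded shuffle product on the reduced tensor coalgebra. -/
def shuffle (k : Type*) [Field k] {ι : Type*} (deg : ι → ℤ) : T k ι →ₗ[k] T k ι →ₗ[k] T k ι :=
  lift (fun u => lift (fun v => shuffleWord k deg u v))

/-- The coderivation of degree one of the reduced tensor coalgebra with Taylor coefficients `m`
(given on words in the basis elements):
`Q (x₁ ⊗ ⋯ ⊗ xₙ) = ∑ ± x₁ ⊗ ⋯ ⊗ xᵢ ⊗ m (xᵢ₊₁ ⊗ ⋯ ⊗ xᵢ₊ₗ) ⊗ xᵢ₊ₗ₊₁ ⊗ ⋯ ⊗ xₙ`, the sum being over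
`0 ≤ i`, `1 ≤ l`, `i + l ≤ n`, with sign `(-1)^(|x₁| + ⋯ + |xᵢ|)`. -/
def coder {k ι : Type*} [Field k] (deg : ι → ℤ) (m : List ι → (ι →₀ k)) : T k ι →ₗ[k] T k ι :=
  lift (fun w => ∑ i ∈ Finset.range w.length, ∑ l ∈ Finset.Icc 1 (w.length - i),
    sgn k (wdeg deg (w.take i)) •
      (m ((w.drop i).take l)).sum
        (fun j c => c • word k (w.take i ++ j :: w.drop (i + l))))

/-- A linear endomorphism of the reduced tensor coalgebra is a unital `C∞` morphism (from the
structure with Taylor coefficients `m` and unit the basis element `e` to itself) if it has degree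
zero, is a morphism of dg bialgebras for the deconcatenation coproduct, the shuffle product and the
codifferential, and satisfies `F₁ e = e` and `Fₙ (⋯ ⊗ e ⊗ ⋯) = 0` for `n ≥ 2`. -/
structure IsUnitalCInf {k ι : Type*} [Field k] (deg : ι → ℤ) (m : List ι → (ι →₀ k)) (e : ι)
    (F : Module.End k (T k ι)) : Prop where
  degree : ∀ w v : {w : List ι // w ≠ []}, F (word k w.1) v ≠ 0 → wdeg deg v.1 = wdeg deg w.1
  comul : ∀ x, TBar.comul k ι (F x) = TensorProduct.map F F (TBar.comul k ι x)
  shuffle : ∀ x y, F (TBar.shuffle k deg x y) = TBar.shuffle k deg (F x) (F y)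
  coder : ∀ x, F (TBar.coder deg m x) = TBar.coder deg m (F x)
  unit_one : proj k ι (F (word k [e])) = Finsupp.single e 1
  unit_zero : ∀ w : List ι, 2 ≤ w.length → e ∈ w → proj k ι (F (word k w)) = 0

section lemmas

variable {k ι : Type*} [Field k]

lemma word_eq (w : {w : List ι // w ≠ []}) : word k w.1 = Finsupp.single w 1 := by
  simp [word, w.2]

lemma lift_word {M : Type*} [AddCommGroup M] [Module k M] (f : List ι → M) {w : List ι}
    (hw : w ≠ []) : lift (k := k) f (word k w) = f w := by
  rw [word_eq ⟨w, hw⟩]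
  simp [lift]

lemma hom_ext {M : Type*} [AddCommGroup M] [Module k M] {f g : T k ι →ₗ[k] M}
    (h : ∀ w : List ι, w ≠ [] → f (word k w) = g (word k w)) : f = g := by
  refine Finsupp.lhom_ext' fun w => LinearMap.ext_ring ?_
  have := h w.1 w.2
  rwa [word_eq] at this

lemma eq_sum (x : T k ι) : x = x.sum fun w c => c • word k w.1 := by
  conv_lhs => rw [← Finsupp.sum_single x]
  exact Finsupp.sum_congr fun w _ => by rw [word_eq]; simp

/-- The coefficient of a word. -/
def coeff (k : Type*) [Field k] {ι : Type*} (w : {w : List ι // w ≠ []}) : T k ι →ₗ[k] k :=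
  Finsupp.lapply w

lemma coeff_word [DecidableEq ι] (w : {w : List ι // w ≠ []}) (v : List ι) :
    coeff k w (word k v) = if v = w.1 then 1 else 0 := by
  by_cases hv : v = []
  · subst hv
    simp [word, coeff, w.2.symm]
  · rw [word_eq ⟨v, hv⟩]
    simp [coeff, Finsupp.single_apply, Subtype.ext_iff]

lemma proj_apply (x : T k ι) (j : ι) : proj k ι x j = x ⟨[j], by simp⟩ := by
  classical
  have : (Finsupp.lapply j).comp (proj k ι) = coeff k (⟨[j], by simp⟩ : {w : List ι // w ≠ []}) := by
    refine hom_ext fun w hw => ?_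
    rw [coeff_word, LinearMap.comp_apply, proj, lift_word _ hw]
    rcases w with _ | ⟨a, _ | ⟨b, w⟩⟩
    · exact absurd rfl hw
    · simp [Finsupp.single_apply]
    · simp
  exact LinearMap.congr_fun this x

/-- The coefficient of `j ⊗ v` in `x` is the coefficient of `[j] ⊗ v` in the coproduct of `x`. -/
lemma coeff_comul (j : ι) (v : {w : List ι // w ≠ []}) (x : T k ι) :
    LinearMap.mul' k k (TensorProduct.map (coeff k ⟨[j], by simp⟩) (coeff k v) (comul k ι x))
      = x ⟨j :: v.1, by simp⟩ := by
  classical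
  have : (LinearMap.mul' k k).comp ((TensorProduct.map (coeff k ⟨[j], by simp⟩) (coeff k v)).comp
      (comul k ι)) = coeff k (⟨j :: v.1, by simp⟩ : {w : List ι // w ≠ []}) := by
    refine hom_ext fun w hw => ?_
    simp only [LinearMap.comp_apply, comul, lift_word _ hw, map_sum, TensorProduct.map_tmul,
      LinearMap.mul'_apply, coeff_word]
    by_cases h : w = j :: v.1
    · rw [Finset.sum_eq_single 1]
      · simp [h]
      · intro i _ hi
        rw [if_neg, zero_mul]
        intro hc
        have := congrArg List.length hc
        have hv := List.length_pos_of_ne_nil v.2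
        simp [h] at this
        omega
      · intro hc
        have hv := List.length_pos_of_ne_nil v.2
        simp [h] at hc
        exact absurd hc v.2
    · rw [if_neg h]
      refine Finset.sum_eq_zero fun i _ => ?_
      by_cases h1 : w.take i = [j]
      · rw [if_neg (c := w.drop i = v.1), mul_zero]
        intro h2
        apply h
        rw [← List.take_append_drop i w, h1, h2]
        rfl
      · simp [h1]
  exact LinearMap.congr_fun this x

/-- A unital morphism preserves the span of the words containing the unit. -/
lemma IsUnitalCInf.mem_of_mem {deg : ι → ℤ} {m : List ι → (ι →₀ k)} {e : ι}
    {F : Module.End k (T k ι)} (hF : IsUnitalCInf deg m e F) (v : List ι) (hv : v ≠ [])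
    (hev : e ∉ v) : ∀ w : List ι, e ∈ w → F (word k w) ⟨v, hv⟩ = 0 := by
  classical
  induction v with
  | nil => exact absurd rfl hv
  | cons j v ih =>
    have hje : e ≠ j := fun h => hev (by simp [h])
    have hsingle : ∀ w : List ι, e ∈ w → F (word k w) ⟨[j], by simp⟩ = 0 := by
      intro w hw
      rw [← proj_apply]
      by_cases hl : 2 ≤ w.length
      · rw [hF.unit_zero w hl hw]
        rfl
      · have : w = [e] := by
          rcases w with _ | ⟨a, _ | ⟨b, w⟩⟩
          · simp at hw
          · simpa [eq_comm] using hw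
          · simp at hl
        rw [this, hF.unit_one, Finsupp.single_eq_of_ne' hje]
    by_cases hv' : v = []
    · subst hv'
      exact hsingle
    · intro w hw
      have hw0 : w ≠ [] := List.ne_nil_of_mem hw
      have hev' : e ∉ v := fun h => hev (by simp [h])
      rw [← coeff_comul j ⟨v, hv'⟩, hF.comul, TBar.comul, lift_word _ hw0]
      simp only [map_sum, TensorProduct.map_tmul, LinearMap.mul'_apply]
      refine Finset.sum_eq_zero fun i _ => ?_
      have : e ∈ w.take i ∨ e ∈ w.drop i := by
        rw [← List.mem_append, List.take_append_drop]
        exact hw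
      rcases this with h | h
      · have := hsingle _ h
        simp [coeff, this]
      · have := ih hv' hev' _ h
        simp [coeff, this]

lemma IsUnitalCInf.one (deg : ι → ℤ) (m : List ι → (ι →₀ k)) (e : ι) :
    IsUnitalCInf deg m e (1 : Module.End k (T k ι)) where
  degree w v h := by
    classical
    rw [Module.End.one_apply, word_eq, Finsupp.single_apply] at h
    have : w = v := by
      by_contra hne
      simp [hne] at h
    rw [this]
  comul x := by simp [Module.End.one_eq_id]
  shuffle _ _ := rfl
  coder _ := rfl
  unit_one := by
    rw [Module.End.one_apply, proj, lift_word _ (by simp)]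
  unit_zero w hw _ := by
    rcases w with _ | ⟨a, _ | ⟨b, w⟩⟩
    · simp at hw
    · simp at hw
    · rw [Module.End.one_apply, proj, lift_word _ (by simp)]

lemma IsUnitalCInf.mul {deg : ι → ℤ} {m : List ι → (ι →₀ k)} {e : ι}
    {G F : Module.End k (T k ι)} (hG : IsUnitalCInf deg m e G) (hF : IsUnitalCInf deg m e F) :
    IsUnitalCInf deg m e (G * F) where
  degree w v h := by
    rw [Module.End.mul_apply, eq_sum (F (word k w.1)), Finsupp.sum, map_sum,
      Finsupp.finsetSum_apply] at h
    obtain ⟨u, hu, hu'⟩ := Finset.exists_ne_zero_of_sum_ne_zero h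
    rw [map_smul, Finsupp.smul_apply, smul_eq_mul] at hu'
    rw [hG.degree u v (right_ne_zero_of_mul hu'), hF.degree w u (left_ne_zero_of_mul hu')]
  comul x := by
    rw [Module.End.mul_apply, hG.comul, hF.comul, ← LinearMap.comp_apply, ← TensorProduct.map_comp]
    rfl
  shuffle x y := by simp only [Module.End.mul_apply, hG.shuffle, hF.shuffle]
  coder x := by simp only [Module.End.mul_apply, hG.coder, hF.coder]
  unit_one := by
    classical
    have key : F (word k [e]) = word k [e] := by
      rw [word_eq ⟨[e], by simp⟩]
      ext ⟨v, hv⟩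
      rw [← word_eq]
      rcases v with _ | ⟨a, _ | ⟨b, v⟩⟩
      · exact absurd rfl hv
      · rw [← proj_apply, hF.unit_one, word_eq]
        simp [Finsupp.single_apply, Subtype.ext_iff]
      · have h1 := coeff_comul (k := k) a ⟨b :: v, by simp⟩ (F (word k [e]))
        rw [hF.comul, TBar.comul, lift_word _ (by simp)] at h1
        rw [← h1, word_eq]
        simp [word, Subtype.ext_iff]
    rw [Module.End.mul_apply, key, hG.unit_one]
  unit_zero w hw hew := by
    rw [Module.End.mul_apply, eq_sum (F (word k w)), Finsupp.sum, map_sum, map_sum]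
    refine Finset.sum_eq_zero fun u hu => ?_
    have hu0 : F (word k w) u ≠ 0 := Finsupp.mem_support_iff.1 hu
    have heu : e ∈ u.1 := by
      by_contra hc
      exact hu0 (hF.mem_of_mem u.1 u.2 hc w hew)
    have hlu : 2 ≤ u.1.length := by
      obtain ⟨u, hune⟩ := u
      rcases u with _ | ⟨a, _ | ⟨b, u⟩⟩
      · exact absurd rfl hune
      · exfalso
        apply hu0
        rw [← proj_apply, hF.unit_zero w hw hew]
        rfl
      · simp
    rw [map_smul, map_smul, hG.unit_zero u.1 hlu heu, smul_zero]

end lemmas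

/-- The monoid of unital `C∞` endomorphisms. -/
def unitalCInfEnd {k ι : Type*} [Field k] (deg : ι → ℤ) (m : List ι → (ι →₀ k)) (e : ι) :
    Submonoid (Module.End k (T k ι)) where
  carrier := {F | IsUnitalCInf deg m e F}
  one_mem' := IsUnitalCInf.one deg m e
  mul_mem' hG hF := IsUnitalCInf.mul hG hF

end TBar

/-! ### The `C∞` algebra of Whitney forms and its automorphisms -/

namespace Whitney

/-- Degrees of the basis elements in the suspension of the Whitney forms:
`|𝐬 1| = |𝐬 t| = -1` and `|𝐬 dt| = 0`. -/
def sdeg : Letter → ℤ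
  | .one => -1
  | .t => -1
  | .dt => 0

/-- The Taylor coefficients `m₁, m₂, m₃, …` of the `C∞` structure on Whitney forms, evaluated on
words in the basis elements `𝐬 1, 𝐬 t, 𝐬 dt`. -/
def taylor (k : Type*) [Field k] : List Letter → (Letter →₀ k)
  | [] => 0
  -- `m₁ = - 𝐬 d`
  | [.one] => 0
  | [.t] => - Finsupp.single .dt 1
  | [.dt] => 0
  -- `1` is a unit: `m₂ (𝐬 1 ⊗ 𝐬 x) = 𝐬 x` and `m₂ (𝐬 x ⊗ 𝐬 1) = (-1)^|x| 𝐬 x`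
  | [.one, x] => Finsupp.single x 1
  | [.t, .one] => Finsupp.single .t 1
  | [.dt, .one] => - Finsupp.single .dt 1
  | [.t, .t] => Finsupp.single .t 1
  -- with `i` arguments `𝐬 dt` in front of the only `𝐬 t`, and `n` arguments `𝐬 dt` in total
  | w =>
      if Letter.one ∉ w ∧ w.count Letter.t = 1 then
        Finsupp.single .dt
          ((-1) ^ (w.idxOf Letter.t + 1) * ((w.length - 1).choose (w.idxOf Letter.t) : k) *
            ((_root_.bernoulli (w.length - 1) : ℚ) : k) / ((w.length - 1).factorial : k))
      else 0

/-- The group of unital `C∞` automorphisms of the `C∞` algebra of Whitney forms. -/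
abbrev AutInf (k : Type*) [Field k] : Type _ :=
  (TBar.unitalCInfEnd sdeg (taylor k) Letter.one)ˣ

/-- The linear part `ψ₁`, the first Taylor coefficient of `ψ`, as an endomorphism of the space of
Whitney forms. -/
def linearPart {k : Type*} [Field k] (ψ : Module.End k (TBar.T k Letter)) :
    Module.End k (forms k) :=
  (basis k).repr.symm.toLinearMap ∘ₗ TBar.proj k Letter ∘ₗ ψ ∘ₗ TBar.incl k Letter ∘ₗ
    (basis k).repr.toLinearMap

/-- The action of `kˣ` on the additive group of `k` by multiplication. -/
def scaling (k : Type*) [Field k] : kˣ →* MulAut (Multiplicative k) where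
  toFun u := AddEquiv.toMultiplicative (DistribMulAction.toAddAut kˣ k u)
  map_one' := by ext x; simp
  map_mul' u v := by
    apply MulEquiv.ext
    intro x
    apply Multiplicative.toAdd.injective
    simp [mul_smul]

end Whitney

end

/-
Words embed the reduced tensor coalgebra into the full one, where a coalgebra endomorphism `F` is
determined by the operators `D j` with `del j * F = F * D j`, `del j` removing a first letter `j`.
Then `F` is multiplicative for the shuffle product as soon as each `D j` is a skew derivation, and
commutes with the codifferential `Q` as soon as the `D j` satisfy the same commutation rules with
`Q` as the `del j`.

For Whitney forms write `x`, `τ`, `o` for `del .dt`, `del .t`, `del .one`. The rules say that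
`d = Q - o` satisfies `[x, d] = -B(ad x) τ` with `B(z) = z / (exp z - 1)`, and that `τ` is a
Maurer-Cartan element: `(d - τ)² = d²`. Hence `τ` is gauge equivalent to `0` along the flow of `x`,
and every `g_s(ad x) τ` with `g_s(z) = (exp (s z) - 1) / (exp z - 1)` is again Maurer-Cartan.
Two times `s`, `s'` of this flow give a morphism with linear part `t ↦ (s' - s) t + s`.

Conversely, for degree reasons a Taylor coefficient is unknown only on words without `1` having
at most one `t`. Shuffle relations kill it when there is no `t` and, for each length, leave a single
parameter otherwise, which compatibility with `Q` on the words `t t dt ⋯ dt` determines in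
characteristic zero.
-/

noncomputable section

/-! ### Power series in the commutator with a lowering operator -/

section

variable {k V : Type*} [CommRing k] [AddCommGroup V] [Module k V]

lemma aeval_apply_mem {T : Module.End k V} {P : Submodule k V} (hT : ∀ v ∈ P, T v ∈ P)
    (p : k[X]) {v : V} (hv : v ∈ P) : aeval T p v ∈ P := by
  induction p using Polynomial.induction_on' with
  | add p q hp hq => rw [map_add]; exact P.add_mem hp hq
  | monomial n c =>
    rw [aeval_monomial, Module.End.mul_apply, Module.algebraMap_end_apply]
    exact P.smul_mem c (Module.End.pow_apply_mem_of_forall_mem n hT v hv)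

end

/-- An exhaustive increasing filtration `0 = F 0 ≤ F 1 ≤ ⋯` of a module. It makes the operators
lowering it locally nilpotent. -/
structure ExhaustiveFiltration (k V : Type*) [CommRing k] [AddCommGroup V] [Module k V] where
  /-- The steps of the filtration. -/
  step : ℕ → Submodule k V
  monotone_step : Monotone step
  step_zero : step 0 = ⊥
  exists_mem_step : ∀ v, ∃ n, v ∈ step n

namespace ExhaustiveFiltration

attribute [local instance] LieRing.ofAssociativeRing

open LieAlgebra (ad)

section

variable {k V : Type*} [CommRing k] [AddCommGroup V] [Module k V] (F : ExhaustiveFiltration k V)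

/-- The operators which lower the filtration by `r`. -/
def lowering (r : ℕ) : Submodule k (Module.End k V) where
  carrier := {D | ∀ n, ∀ v ∈ F.step (n + r), D v ∈ F.step n}
  add_mem' hD hE n v hv := (F.step n).add_mem (hD n v hv) (hE n v hv)
  zero_mem' n _ _ := (F.step n).zero_mem
  smul_mem' c _ hD n v hv := (F.step n).smul_mem c (hD n v hv)

variable {F} in
lemma mul_mem_lowering {r s : ℕ} {D E : Module.End k V} (hD : D ∈ F.lowering r)
    (hE : E ∈ F.lowering s) : D * E ∈ F.lowering (r + s) :=
  fun n v hv => hD n _ (hE (n + r) v (by rwa [add_assoc]))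

lemma lowering_antitone : Antitone F.lowering :=
  fun _ _ hrs _ hD n v hv => hD n v (F.monotone_step (by gcongr) hv)

variable {F} in
lemma apply_eq_zero_of_mem_lowering {r : ℕ} {D : Module.End k V} (hD : D ∈ F.lowering r) {v : V}
    (hv : v ∈ F.step r) : D v = 0 := by
  simpa [F.step_zero] using hD 0 v (by rwa [zero_add])

/-- The algebra of operators preserving the filtration. -/
def preserving : Subalgebra k (Module.End k V) where
  carrier := F.lowering 0
  mul_mem' := mul_mem_lowering
  add_mem' := (F.lowering 0).add_mem
  algebraMap_mem' c n _ hv := (F.step n).smul_mem c hv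

-- Stated for variable `V`, these two instances are found by unification also when the additive
-- monoid of a concrete `V` does not syntactically come from its additive group.
instance : Ring F.preserving := F.preserving.toRing

instance : Algebra k F.preserving := F.preserving.algebra

/-- Submodules of operators closed under pointwise limits: an operator which on each step of the
filtration agrees with some member is itself a member. -/
def IsPointwiseClosed (P : Submodule k (Module.End k V)) : Prop :=
  ∀ D, (∀ N, ∃ E ∈ P, ∀ v ∈ F.step N, D v = E v) → D ∈ P

variable {F}

lemma isPointwiseClosed_lowering (r : ℕ) : F.IsPointwiseClosed (F.lowering r) :=
  fun D hD n v hv => by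
    obtain ⟨E, hE, hDE⟩ := hD (n + r)
    rw [hDE v hv]
    exact hE n v hv

lemma lowering_le_preserving (r : ℕ) : F.lowering r ≤ Subalgebra.toSubmodule F.preserving :=
  F.lowering_antitone (Nat.zero_le r)

lemma commutator_mem_lowering {r s : ℕ} {D E : Module.End k V} (hD : D ∈ F.lowering r)
    (hE : E ∈ F.lowering s) : D * E - E * D ∈ F.lowering (r + s) :=
  (F.lowering (r + s)).sub_mem (mul_mem_lowering hD hE) (add_comm r s ▸ mul_mem_lowering hE hD)

lemma ad_mem_lowering {r s : ℕ} {x a : F.preserving} (hx : (x : Module.End k V) ∈ F.lowering r)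
    (ha : (a : Module.End k V) ∈ F.lowering s) :
    (ad k F.preserving x a : Module.End k V) ∈ F.lowering (r + s) :=
  commutator_mem_lowering hx ha

lemma ad_pow_mem_lowering {x : F.preserving} (hx : (x : Module.End k V) ∈ F.lowering 1)
    (a : F.preserving) (n : ℕ) :
    ((ad k F.preserving x ^ n) a : Module.End k V) ∈ F.lowering n := by
  induction n with
  | zero => exact a.2
  | succ n ih => rw [pow_succ', add_comm]; exact ad_mem_lowering hx ih

variable (F) in
/-- The operators preserving the filtration which vanish on a given step. -/
def vanishingOn (N : ℕ) : Submodule k F.preserving where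
  carrier := {a | ∀ v ∈ F.step N, (a : Module.End k V) v = 0}
  add_mem' ha hb v hv := by simp [ha v hv, hb v hv]
  zero_mem' _ _ := rfl
  smul_mem' c a ha v hv := by simp [ha v hv]

lemma ad_mem_vanishingOn (x : F.preserving) {N : ℕ} {a : F.preserving} (ha : a ∈ F.vanishingOn N) :
    ad k F.preserving x a ∈ F.vanishingOn N := fun v hv => by
  rw [LieAlgebra.ad_apply, Ring.lie_def, Subalgebra.coe_sub, Subalgebra.coe_mul,
    Subalgebra.coe_mul, LinearMap.sub_apply, Module.End.mul_apply, Module.End.mul_apply, ha v hv,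
    ha _ (x.2 N v hv), map_zero, sub_zero]

lemma modEq_vanishingOn {N : ℕ} {a b : F.preserving} :
    a ≡ b [SMOD F.vanishingOn N] ↔
      ∀ v ∈ F.step N, (a : Module.End k V) v = (b : Module.End k V) v := by
  rw [SModEq.sub_mem]
  exact forall₂_congr fun v _ => sub_eq_zero

lemma eq_of_forall_modEq {a b : F.preserving} (h : ∀ N, a ≡ b [SMOD F.vanishingOn N]) : a = b := by
  refine Subtype.ext (LinearMap.ext fun v => ?_)
  obtain ⟨N, hv⟩ := F.exists_mem_step v
  exact modEq_vanishingOn.1 (h N) v hv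

lemma aeval_ad_modEq_of_modEq (x : F.preserving) (p : k[X]) {N : ℕ} {a b : F.preserving}
    (h : a ≡ b [SMOD F.vanishingOn N]) :
    aeval (ad k F.preserving x) p a ≡ aeval (ad k F.preserving x) p b [SMOD F.vanishingOn N] := by
  rw [SModEq.sub_mem, ← map_sub]
  exact aeval_apply_mem (fun _ => ad_mem_vanishingOn x) p (SModEq.sub_mem.1 h)

lemma aeval_ad_mul_eq_mul_aeval_ad {x y φ a b : F.preserving} (hxy : x * φ = φ * y)
    (hab : a * φ = φ * b) (p : k[X]) :
    aeval (ad k F.preserving x) p a * φ = φ * aeval (ad k F.preserving y) p b := by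
  have hpow (n : ℕ) : (ad k F.preserving x ^ n) a * φ = φ * (ad k F.preserving y ^ n) b := by
    induction n generalizing a b with
    | zero => exact hab
    | succ _ ih =>
      refine ih ?_
      simp only [LieAlgebra.ad_apply, Ring.lie_def, sub_mul, mul_sub, mul_assoc, hab, hxy]
      simp only [← mul_assoc, hab, hxy]
  induction p using Polynomial.induction_on' with
  | add p q hp hq => rw [map_add, map_add, LinearMap.add_apply, LinearMap.add_apply, add_mul,
      mul_add, hp, hq]
  | monomial n c => simp only [aeval_monomial, Module.End.mul_apply, Module.algebraMap_end_apply,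
      smul_mul_assoc, mul_smul_comm, hpow]

section

variable {x : F.preserving} (hx : (x : Module.End k V) ∈ F.lowering 1)

include hx in
lemma aeval_ad_modEq_of_coeff_eq {p q : k[X]} {N : ℕ} (hpq : ∀ i < N, p.coeff i = q.coeff i)
    (a : F.preserving) :
    aeval (ad k F.preserving x) p a ≡ aeval (ad k F.preserving x) q a [SMOD F.vanishingOn N] := by
  obtain ⟨r, hr⟩ := (X_pow_dvd_iff (f := p - q)).2 fun i hi => by rw [coeff_sub, hpq i hi, sub_self]
  rw [SModEq.sub_mem, ← LinearMap.sub_apply, ← map_sub, hr, map_mul, map_pow, aeval_X]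
  exact fun v hv => apply_eq_zero_of_mem_lowering (ad_pow_mem_lowering hx _ N) hv

include hx in
lemma exists_modEq_aeval_trunc (f : PowerSeries k) (a : F.preserving) :
    ∃ b : F.preserving,
      ∀ N, b ≡ aeval (ad k F.preserving x) (f.trunc N) a [SMOD F.vanishingOn N] := by
  choose order h_order using F.exists_mem_step
  let value (N : ℕ) : Module.End k V := aeval (ad k F.preserving x) (f.trunc N) a
  have value_eq {M N : ℕ} (hMN : M ≤ N) {v : V} (hv : v ∈ F.step M) : value N v = value M v :=
    modEq_vanishingOn.1 (aeval_ad_modEq_of_coeff_eq hx (fun i hi => by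
      rw [PowerSeries.coeff_trunc, PowerSeries.coeff_trunc, if_pos hi, if_pos (hi.trans_le hMN)])
      a) v hv
  have value_order {N : ℕ} {v : V} (hv : v ∈ F.step N) : value (order v) v = value N v :=
    (le_total N (order v)).elim (fun h => value_eq h hv) fun h => (value_eq h (h_order v)).symm
  let limit : Module.End k V :=
    { toFun v := value (order v) v
      map_add' u v := by
        have hu := F.monotone_step (le_max_left (order u) (order v)) (h_order u)
        have hv := F.monotone_step (le_max_right (order u) (order v)) (h_order v)
        rw [value_order hu, value_order hv, value_order (Submodule.add_mem _ hu hv), map_add]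
      map_smul' c v := by
        rw [value_order (Submodule.smul_mem _ c (h_order v)), map_smul, RingHom.id_apply] }
  refine ⟨⟨limit, fun N v hv => ?_⟩, fun N => modEq_vanishingOn.2 fun v hv => value_order hv⟩
  change value (order v) v ∈ F.step N
  rw [value_order (N := N) hv]
  exact (aeval (ad k F.preserving x) (f.trunc N) a).2 N v hv

/-- The value `f (ad x) a` of a power series `f` in the commutator with an operator `x` lowering
the filtration. On each step of the filtration it is given by a truncation of `f`. -/
def adSeriesApply (f : PowerSeries k) (a : F.preserving) : F.preserving :=
  (exists_modEq_aeval_trunc hx f a).choose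

lemma adSeriesApply_modEq {f : PowerSeries k} {p : k[X]} {N : ℕ}
    (hp : ∀ i < N, p.coeff i = PowerSeries.coeff i f) (a : F.preserving) :
    adSeriesApply hx f a ≡ aeval (ad k F.preserving x) p a [SMOD F.vanishingOn N] :=
  ((exists_modEq_aeval_trunc hx f a).choose_spec N).trans <|
    aeval_ad_modEq_of_coeff_eq hx
      (fun i hi => by rw [PowerSeries.coeff_trunc, if_pos hi, hp i hi]) a

lemma adSeriesApply_modEq_trunc (f : PowerSeries k) (N : ℕ) (a : F.preserving) :
    adSeriesApply hx f a ≡ aeval (ad k F.preserving x) (f.trunc N) a [SMOD F.vanishingOn N] :=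
  (exists_modEq_aeval_trunc hx f a).choose_spec N

lemma adSeriesApply_one (a : F.preserving) : adSeriesApply hx 1 a = a :=
  eq_of_forall_modEq fun N =>
    (adSeriesApply_modEq hx (p := 1) (fun i _ => by rw [← coe_one, coeff_coe]) a).trans
      (by rw [map_one, Module.End.one_apply])

lemma adSeriesApply_mul (f g : PowerSeries k) (a : F.preserving) :
    adSeriesApply hx (f * g) a = adSeriesApply hx f (adSeriesApply hx g a) := by
  refine eq_of_forall_modEq fun N => ?_
  have coeff_mul : ∀ i < N, (f.trunc N * g.trunc N).coeff i = PowerSeries.coeff i (f * g) := by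
    intro i hi
    rw [PowerSeries.coeff_mul_eq_coeff_trunc_mul_trunc f g hi, ← coe_mul, coeff_coe]
  refine (adSeriesApply_modEq hx coeff_mul a).trans ?_
  rw [map_mul, Module.End.mul_apply]
  exact (aeval_ad_modEq_of_modEq x _ (adSeriesApply_modEq_trunc hx g N a).symm).trans
    (adSeriesApply_modEq_trunc hx f N _).symm

/-- The action of the power series on the operators preserving the filtration in which the
variable acts as the commutator with an operator `x` lowering the filtration. -/
def adSeries : PowerSeries k →ₐ[k] Module.End k F.preserving :=
  AlgHom.ofLinearMap
    (LinearMap.mk₂ k (adSeriesApply hx)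
      (fun f g a => eq_of_forall_modEq fun N => by
        simpa only [map_add, LinearMap.add_apply] using
          (adSeriesApply_modEq_trunc hx (f + g) N a).trans <| .trans (by simp) <|
            ((adSeriesApply_modEq_trunc hx f N a).add (adSeriesApply_modEq_trunc hx g N a)).symm)
      (fun c f a => eq_of_forall_modEq fun N =>
        (adSeriesApply_modEq_trunc hx (c • f) N a).trans <| .trans (by simp) <|
          ((adSeriesApply_modEq_trunc hx f N a).smul c).symm)
      (fun f a b => eq_of_forall_modEq fun N =>
        (adSeriesApply_modEq_trunc hx f N (a + b)).trans <| .trans (by rw [map_add]) <|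
          ((adSeriesApply_modEq_trunc hx f N a).add (adSeriesApply_modEq_trunc hx f N b)).symm)
      (fun c f a => eq_of_forall_modEq fun N =>
        (adSeriesApply_modEq_trunc hx f N (c • a)).trans <| .trans (by rw [map_smul]) <|
          ((adSeriesApply_modEq_trunc hx f N a).smul c).symm))
    (LinearMap.ext (adSeriesApply_one hx))
    (fun f g => LinearMap.ext (adSeriesApply_mul hx f g))

lemma adSeries_modEq {f : PowerSeries k} {p : k[X]} {N : ℕ}
    (hp : ∀ i < N, p.coeff i = PowerSeries.coeff i f) (a : F.preserving) :
    adSeries hx f a ≡ aeval (ad k F.preserving x) p a [SMOD F.vanishingOn N] :=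
  adSeriesApply_modEq hx hp a

lemma adSeries_modEq_trunc (f : PowerSeries k) (N : ℕ) (a : F.preserving) :
    adSeries hx f a ≡ aeval (ad k F.preserving x) (f.trunc N) a [SMOD F.vanishingOn N] :=
  adSeriesApply_modEq_trunc hx f N a

lemma adSeries_apply_of_mem_step (f : PowerSeries k) (a : F.preserving) {N : ℕ} {v : V}
    (hv : v ∈ F.step N) : (adSeries hx f a : Module.End k V) v =
      ∑ n ∈ Finset.range N,
        PowerSeries.coeff n f • ((ad k F.preserving x ^ n) a : Module.End k V) v := by
  rw [modEq_vanishingOn.1 (adSeries_modEq_trunc hx f N a) v hv, PowerSeries.trunc_apply,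
    Finset.range_eq_Ico, map_sum, LinearMap.sum_apply, AddSubmonoidClass.coe_finsetSum,
    LinearMap.sum_apply]
  refine Finset.sum_congr rfl fun n _ => ?_
  rw [aeval_monomial, ← Algebra.smul_def]
  rfl

lemma adSeries_X (a : F.preserving) : adSeries hx PowerSeries.X a = ⁅x, a⁆ := by
  refine eq_of_forall_modEq fun N =>
    (adSeries_modEq hx (p := X) (fun i _ => by rw [← coe_X, coeff_coe]) a).trans ?_
  rw [aeval_X, LieAlgebra.ad_apply]

lemma adSeries_smul {c : k} (hcx : ((c • x : F.preserving) : Module.End k V) ∈ F.lowering 1)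
    (f : PowerSeries k) : adSeries hcx f = adSeries hx (PowerSeries.rescale c f) := by
  refine LinearMap.ext fun a => eq_of_forall_modEq fun N => (adSeries_modEq_trunc hcx f N a).trans
    (SModEq.trans ?_ (adSeries_modEq hx (p := (f.trunc N).comp (C c * X)) (fun i hi => ?_) a).symm)
  · rw [aeval_comp, map_mul, aeval_C, aeval_X, ← Algebra.smul_def, map_smul]
  · rw [comp_C_mul_X_coeff, PowerSeries.coeff_trunc, if_pos hi, PowerSeries.coeff_rescale, mul_comm]

lemma adSeries_mem (f : PowerSeries k) {P : Submodule k (Module.End k V)}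
    (hP : F.IsPointwiseClosed P)
    (hxP : ∀ D ∈ P, (x : Module.End k V) * D - D * (x : Module.End k V) ∈ P)
    {a : F.preserving} (ha : (a : Module.End k V) ∈ P) :
    (adSeries hx f a : Module.End k V) ∈ P := by
  refine hP _ fun N => ⟨_, ?_, modEq_vanishingOn.1 (adSeries_modEq_trunc hx f N a)⟩
  exact aeval_apply_mem (P := P.comap F.preserving.val.toLinearMap) (fun a ha => hxP a ha) _ ha

lemma adSeries_mul_eq_mul_adSeries {y φ a b : F.preserving}
    (hy : (y : Module.End k V) ∈ F.lowering 1) (hxy : x * φ = φ * y) (hab : a * φ = φ * b)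
    (f : PowerSeries k) : adSeries hx f a * φ = φ * adSeries hy f b := by
  refine eq_of_forall_modEq fun N => modEq_vanishingOn.2 fun v hv => ?_
  have ha := modEq_vanishingOn.1 (adSeries_modEq_trunc hx f N a) _ (φ.2 N v hv)
  have hb := modEq_vanishingOn.1 (adSeries_modEq_trunc hy f N b) v hv
  rw [Subalgebra.coe_mul, Subalgebra.coe_mul, Module.End.mul_apply, Module.End.mul_apply, ha, hb]
  exact LinearMap.congr_fun
    (congrArg Subtype.val (aeval_ad_mul_eq_mul_aeval_ad hxy hab (f.trunc N))) v

end

end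

section exp

variable {k V : Type*} [CommRing k] [AddCommGroup V] [Module k V]
  {F : ExhaustiveFiltration k V} {x : F.preserving}

/-- Restriction of the operators preserving the filtration to one of its steps. -/
def restrictStep (F : ExhaustiveFiltration k V) (N : ℕ) :
    F.preserving →ₐ[k] Module.End k (F.step N) where
  toFun a := (a : Module.End k V).restrict (a.2 N)
  map_one' := rfl
  map_mul' _ _ := rfl
  map_zero' := rfl
  map_add' _ _ := rfl
  commutes' _ := rfl

lemma restrictStep_eq_iff {N : ℕ} {a b : F.preserving} :
    F.restrictStep N a = F.restrictStep N b ↔ a ≡ b [SMOD F.vanishingOn N] := by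
  rw [modEq_vanishingOn, LinearMap.ext_iff, SetLike.forall]
  exact forall₂_congr fun v hv => Subtype.ext_iff

variable (hx : (x : Module.End k V) ∈ F.lowering 1)

include hx in
lemma restrictStep_pow_eq_zero (N : ℕ) : F.restrictStep N x ^ N = 0 := by
  have hxN : ((x ^ N : F.preserving) : Module.End k V) ∈ F.lowering N := by
    induction N with
    | zero => exact (1 : F.preserving).2
    | succ N ih => rw [pow_succ]; exact mul_mem_lowering ih hx
  rw [← map_pow, ← map_zero (F.restrictStep N), restrictStep_eq_iff, modEq_vanishingOn]
  exact fun v hv => apply_eq_zero_of_mem_lowering hxN hv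

lemma restrictStep_aeval_ad (p : k[X]) (N : ℕ) (a : F.preserving) :
    F.restrictStep N (aeval (ad k F.preserving x) p a) =
      aeval (ad k _ (F.restrictStep N x)) p (F.restrictStep N a) := by
  have h_comp : ad k _ (F.restrictStep N x) ∘ₗ (F.restrictStep N).toLinearMap =
      (F.restrictStep N).toLinearMap ∘ₗ ad k F.preserving x :=
    LinearMap.ext fun b => by simp [Ring.lie_def]
  have h_pow (n : ℕ) : F.restrictStep N ((ad k F.preserving x ^ n) a) =
      (ad k _ (F.restrictStep N x) ^ n) (F.restrictStep N a) :=
    (LinearMap.congr_fun (Module.End.commute_pow_left_of_commute h_comp n) a).symm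
  simp only [aeval_eq_sum_range, LinearMap.sum_apply, LinearMap.smul_apply, map_sum, map_smul,
    h_pow]

variable [Algebra ℚ k]

lemma restrictStep_adSeries_exp {N : ℕ} [Module ℚ (Module.End k (F.step N))] (a : F.preserving) :
    F.restrictStep N (adSeries hx (PowerSeries.exp k) a) =
      IsNilpotent.exp (ad k _ (F.restrictStep N x)) (F.restrictStep N a) := by
  obtain ⟨K, hK⟩ := LieAlgebra.ad_nilpotent_of_nilpotent (R := k)
    ⟨N, restrictStep_pow_eq_zero hx N⟩
  have hNK := le_max_left N K
  rw [IsNilpotent.exp_eq_sum (k := max N K) (pow_eq_zero_of_le (le_max_right N K) hK),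
    restrictStep_eq_iff.2 (adSeries_modEq hx (p := (PowerSeries.exp k).trunc (max N K))
      (fun i hi => by rw [PowerSeries.coeff_trunc, if_pos (hi.trans_le hNK)]) a),
    restrictStep_aeval_ad, PowerSeries.trunc_apply, Finset.range_eq_Ico, map_sum]
  refine LinearMap.congr_fun (Finset.sum_congr rfl fun n _ => ?_) _
  rw [aeval_monomial, PowerSeries.coeff_exp, ← Algebra.smul_def, algebraMap_smul, one_div]

lemma adSeries_exp_mul (a b : F.preserving) :
    adSeries hx (PowerSeries.exp k) (a * b) =
      adSeries hx (PowerSeries.exp k) a * adSeries hx (PowerSeries.exp k) b := by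
  refine eq_of_forall_modEq fun N => restrictStep_eq_iff.1 ?_
  let : Module ℚ (Module.End k (F.step N)) := Module.compHom _ (algebraMap ℚ k)
  rw [map_mul (F.restrictStep N), restrictStep_adSeries_exp, restrictStep_adSeries_exp,
    restrictStep_adSeries_exp, map_mul (F.restrictStep N)]
  refine Module.End.exp_mul_of_derivation k _ _ (fun u v => ?_)
    (LieAlgebra.ad_nilpotent_of_nilpotent ⟨N, restrictStep_pow_eq_zero hx N⟩) _ _
  simp only [LieAlgebra.ad_apply, Ring.lie_def, mul_sub, sub_mul, mul_assoc]
  abel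

end exp

end ExhaustiveFiltration

/-! ### Gauge flow -/

section

variable (k : Type*) [CommRing k] [Algebra ℚ k]

/-- The power series `(exp (s z) - 1) / z`. -/
def expQuot (s : k) : PowerSeries k :=
  PowerSeries.mk fun n => s ^ (n + 1) * algebraMap ℚ k (1 / (n + 1).factorial)

/-- The power series `(exp (s z) - 1) / (exp z - 1)`. -/
def gaugeSeries (s : k) : PowerSeries k := bernoulliPowerSeries k * expQuot k s

variable {k}

lemma X_mul_expQuot (s : k) :
    PowerSeries.X * expQuot k s = PowerSeries.rescale s (PowerSeries.exp k) - 1 := by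
  ext n
  cases n with
  | zero =>
    rw [PowerSeries.coeff_zero_X_mul, map_sub, PowerSeries.coeff_rescale, PowerSeries.coeff_exp]
    simp
  | succ n =>
    rw [PowerSeries.coeff_succ_X_mul, expQuot, PowerSeries.coeff_mk, map_sub,
      PowerSeries.coeff_rescale, PowerSeries.coeff_exp, PowerSeries.coeff_one,
      if_neg n.succ_ne_zero, sub_zero]

lemma gaugeSeries_one : gaugeSeries k 1 = 1 := by
  refine PowerSeries.X_mul_cancel ?_
  rw [gaugeSeries, mul_left_comm, X_mul_expQuot, PowerSeries.rescale_one, RingHom.id_apply,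
    bernoulliPowerSeries_mul_exp_sub_one, mul_one]

lemma coeff_zero_bernoulliPowerSeries : PowerSeries.coeff 0 (bernoulliPowerSeries k) = 1 := by
  simp [bernoulliPowerSeries]

lemma coeff_zero_gaugeSeries (s : k) : PowerSeries.coeff 0 (gaugeSeries k s) = s := by
  rw [gaugeSeries, PowerSeries.coeff_mul, Finset.Nat.antidiagonal_zero, Finset.sum_singleton,
    coeff_zero_bernoulliPowerSeries, one_mul, expQuot, PowerSeries.coeff_mk]
  simp

lemma rescale_bernoulliPowerSeries_mul_gaugeSeries_sub (s s' : k) :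
    PowerSeries.rescale (s' - s) (bernoulliPowerSeries k) * (gaugeSeries k s' - gaugeSeries k s) =
      PowerSeries.C (s' - s) * (bernoulliPowerSeries k + PowerSeries.X * gaugeSeries k s) := by
  refine PowerSeries.X_mul_cancel ?_
  have hs := X_mul_expQuot s
  have hs' := X_mul_expQuot s'
  have h_exp_add : PowerSeries.rescale s' (PowerSeries.exp k) =
      PowerSeries.rescale (s' - s) (PowerSeries.exp k) *
        PowerSeries.rescale s (PowerSeries.exp k) := by
    rw [PowerSeries.exp_mul_exp_eq_exp_add, sub_add_cancel]
  have h_rescale := congrArg (PowerSeries.rescale (s' - s))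
    (bernoulliPowerSeries_mul_exp_sub_one k)
  rw [map_mul, map_sub, map_one, PowerSeries.rescale_X] at h_rescale
  rw [h_exp_add] at hs'
  simp only [gaugeSeries]
  linear_combination (PowerSeries.rescale (s' - s) (bernoulliPowerSeries k) *
    bernoulliPowerSeries k) * (hs' - hs) + bernoulliPowerSeries k *
    PowerSeries.rescale s (PowerSeries.exp k) * h_rescale -
      PowerSeries.C (s' - s) * PowerSeries.X * bernoulliPowerSeries k * hs

end

namespace ExhaustiveFiltration

attribute [local instance] LieRing.ofAssociativeRing

variable {k V : Type*} [CommRing k] [Algebra ℚ k] [AddCommGroup V] [Module k V]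
  {F : ExhaustiveFiltration k V} {x d τ : F.preserving}
  (hx : (x : Module.End k V) ∈ F.lowering 1)

/-- The flow of `x` on the elements gauge equivalent to zero: the action of `exp (s ad x)` changes
the differential `d` into `d - gaugeFlow hx τ s` if `τ` is its value at time `1`. -/
def gaugeFlow (τ : F.preserving) (s : k) : F.preserving :=
  adSeries hx (gaugeSeries k s) τ

lemma gaugeFlow_one (τ : F.preserving) : gaugeFlow hx τ 1 = τ := by
  rw [gaugeFlow, gaugeSeries_one, map_one, Module.End.one_apply]

lemma adSeries_rescale_exp (s : k) (a : F.preserving) :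
    adSeries hx (PowerSeries.rescale s (PowerSeries.exp k)) a =
      a + adSeries hx (expQuot k s) ⁅x, a⁆ := by
  rw [eq_add_of_sub_eq' (X_mul_expQuot s).symm, map_add, map_one, LinearMap.add_apply,
    Module.End.one_apply, mul_comm, map_mul, Module.End.mul_apply, adSeries_X]

lemma adSeries_rescale_exp_mul (s : k) (a b : F.preserving) :
    adSeries hx (PowerSeries.rescale s (PowerSeries.exp k)) (a * b) =
      adSeries hx (PowerSeries.rescale s (PowerSeries.exp k)) a *
        adSeries hx (PowerSeries.rescale s (PowerSeries.exp k)) b := by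
  have hsx : ((s • x : F.preserving) : Module.End k V) ∈ F.lowering 1 :=
    (F.lowering 1).smul_mem s hx
  simp only [← adSeries_smul hx hsx, adSeries_exp_mul]

lemma adSeries_rescale_exp_eq_sub_gaugeFlow
    (h_gauge : ⁅x, d⁆ = -adSeries hx (bernoulliPowerSeries k) τ) (s : k) :
    adSeries hx (PowerSeries.rescale s (PowerSeries.exp k)) d = d - gaugeFlow hx τ s := by
  rw [adSeries_rescale_exp, h_gauge, map_neg, ← Module.End.mul_apply, ← map_mul,
    mul_comm, ← gaugeSeries, ← sub_eq_add_neg, gaugeFlow]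

lemma lie_eq_zero_of_adSeries_exp_eq {a : F.preserving}
    (ha : adSeries hx (PowerSeries.exp k) a = a) : ⁅x, a⁆ = 0 := by
  rw [← adSeries_X hx, ← bernoulliPowerSeries_mul_exp_sub_one k, map_mul, Module.End.mul_apply,
    map_sub, LinearMap.sub_apply, ha, map_one, Module.End.one_apply, sub_self, map_zero]

/-- The gauge group acts on differentials by conjugation, so it preserves the Maurer–Cartan
equation. -/
lemma sub_gaugeFlow_mul_self (h_gauge : ⁅x, d⁆ = -adSeries hx (bernoulliPowerSeries k) τ)
    (hτ : (d - τ) * (d - τ) = d * d) (s : k) :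
    (d - gaugeFlow hx τ s) * (d - gaugeFlow hx τ s) = d * d := by
  have h_exp (s : k) : adSeries hx (PowerSeries.rescale s (PowerSeries.exp k)) (d * d) =
      (d - gaugeFlow hx τ s) * (d - gaugeFlow hx τ s) := by
    rw [adSeries_rescale_exp_mul, adSeries_rescale_exp_eq_sub_gaugeFlow hx h_gauge]
  have h_lie : ⁅x, d * d⁆ = 0 := lie_eq_zero_of_adSeries_exp_eq hx <| by
    simpa only [PowerSeries.rescale_one, RingHom.id_apply, gaugeFlow_one, hτ] using h_exp 1
  rw [← h_exp, adSeries_rescale_exp, h_lie, map_zero, add_zero]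

end ExhaustiveFiltration

/-! ### The full tensor coalgebra and its word derivatives -/

namespace TBar

/-- The full tensor coalgebra `⨁ n ≥ 0, V ⊗ ⋯ ⊗ V`, with its basis of all words in the basis
elements of `V`. -/
abbrev Full (k ι : Type*) [CommRing k] : Type _ := List ι →₀ k

section full

variable {k ι : Type*} [CommRing k]

/-- The basis element of the full tensor coalgebra given by a word. -/
abbrev fullWord (k : Type*) [CommRing k] {ι : Type*} (w : List ι) : Full k ι := Finsupp.single w 1

lemma full_hom_ext {M : Type*} [AddCommGroup M] [Module k M] {f g : Full k ι →ₗ[k] M}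
    (h : ∀ w, f (fullWord k w) = g (fullWord k w)) : f = g :=
  Finsupp.lhom_ext' fun w => LinearMap.ext_ring (h w)

variable (k ι) in
/-- The filtration of the full tensor coalgebra by the length of words. -/
def lengthFiltration : ExhaustiveFiltration k (Full k ι) where
  step n := Finsupp.supported k k {w | w.length < n}
  monotone_step _ _ h := Finsupp.supported_mono fun _ hw => lt_of_lt_of_le hw h
  step_zero := by simp
  exists_mem_step x := ⟨x.support.sup List.length + 1,
    fun _ hw => Nat.lt_succ_of_le (Finset.le_sup (f := List.length) hw)⟩

lemma mem_step {n : ℕ} {x : Full k ι} :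
    x ∈ (lengthFiltration k ι).step n ↔ ∀ w : List ι, n ≤ w.length → x w = 0 :=
  (Finsupp.mem_supported' k x).trans <| forall_congr' fun _ => imp_congr_left (not_lt (α := ℕ))

lemma fullWord_mem_step {n : ℕ} {w : List ι} (hw : w.length < n) :
    fullWord k w ∈ (lengthFiltration k ι).step n :=
  Finsupp.single_mem_supported k 1 hw

lemma map_mem_of_mem_step {M : Type*} [AddCommGroup M] [Module k M] {P : Submodule k M}
    {f : Full k ι →ₗ[k] M} {n : ℕ} (h : ∀ w, w.length < n → f (fullWord k w) ∈ P)
    {x : Full k ι} (hx : x ∈ (lengthFiltration k ι).step n) : f x ∈ P := by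
  have h_span : (lengthFiltration k ι).step n =
      Submodule.span k (fullWord k '' {w | w.length < n}) := Finsupp.supported_eq_span_single k _
  rw [h_span] at hx
  exact (Submodule.span_le (p := P.comap f)).2 (Set.forall_mem_image.2 fun w hw => h w hw) hx

/-- The operator removing a letter from the front of a word. -/
def del (k : Type*) [CommRing k] {ι : Type*} (j : ι) : Module.End k (Full k ι) :=
  Finsupp.lcomapDomain (List.cons j) List.cons_injective

lemma del_apply (j : ι) (x : Full k ι) (v : List ι) : del k j x v = x (j :: v) := rfl

lemma del_fullWord_nil (j : ι) : del k j (fullWord k []) = 0 := by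
  ext v
  exact Finsupp.single_eq_of_ne (List.cons_ne_nil j v)

lemma del_fullWord_cons [DecidableEq ι] (j a : ι) (w : List ι) :
    del k j (fullWord k (a :: w)) = if a = j then fullWord k w else 0 := by
  ext v
  split_ifs with h <;> simp [del_apply, Finsupp.single_apply, h]

lemma ext_del {x y : Full k ι} (h_nil : x [] = y []) (h_del : ∀ j, del k j x = del k j y) :
    x = y := by
  ext (_ | ⟨j, v⟩)
  · exact h_nil
  · exact DFunLike.congr_fun (h_del j) v

lemma del_mem_lowering (j : ι) : del k j ∈ (lengthFiltration k ι).lowering 1 := fun _ _ hx =>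
  mem_step.2 fun w hw => mem_step.1 hx (j :: w) (by simpa using hw)

/-- Left tensoring with a basis element. -/
def consFull (k : Type*) [CommRing k] {ι : Type*} (j : ι) : Module.End k (Full k ι) :=
  Finsupp.lmapDomain k k (List.cons j)

lemma consFull_fullWord (j : ι) (w : List ι) :
    consFull k j (fullWord k w) = fullWord k (j :: w) := Finsupp.mapDomain_single

lemma consFull_nil (j : ι) (x : Full k ι) : consFull k j x [] = 0 :=
  Finsupp.mapDomain_of_notMem_range x [] (by simp)

lemma del_consFull [DecidableEq ι] (i j : ι) (x : Full k ι) :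
    del k i (consFull k j x) = if j = i then x else 0 := by
  have : del k i ∘ₗ consFull k j = if j = i then LinearMap.id else 0 := full_hom_ext fun w => by
    rw [LinearMap.comp_apply, consFull_fullWord, del_fullWord_cons]
    split_ifs <;> rfl
  rw [← LinearMap.comp_apply, this]
  split_ifs <;> rfl

lemma consFull_mem_step {n : ℕ} {j : ι} {x : Full k ι}
    (hx : x ∈ (lengthFiltration k ι).step n) :
    consFull k j x ∈ (lengthFiltration k ι).step (n + 1) :=
  map_mem_of_mem_step (fun w hw => by
    rw [consFull_fullWord]; exact fullWord_mem_step (Nat.succ_lt_succ hw)) hx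

/-! ### Operators commuting with the right coaction -/

/-- The operator removing a given word from the end of a word. -/
def dropEnd (k : Type*) [CommRing k] {ι : Type*} (v : List ι) : Module.End k (Full k ι) :=
  Finsupp.lcomapDomain (· ++ v) (List.append_left_injective v)

lemma dropEnd_apply (v : List ι) (x : Full k ι) (u : List ι) : dropEnd k v x u = x (u ++ v) := rfl

lemma dropEnd_mem_preserving (v : List ι) : dropEnd k v ∈ (lengthFiltration k ι).preserving :=
  fun _ _ hx => mem_step.2 fun w hw => mem_step.1 hx (w ++ v) (by rw [List.length_append]; omega)

lemma dropEnd_fullWord [DecidableEq ι] (v w : List ι) :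
    dropEnd k v (fullWord k w) =
      ∑ i ∈ Finset.range (w.length + 1), if w.drop i = v then fullWord k (w.take i) else 0 := by
  by_cases h : v <:+ w
  · obtain ⟨u, rfl⟩ := h
    rw [Finset.sum_eq_single u.length]
    · ext z
      simp [dropEnd_apply, Finsupp.single_apply]
    · intro i hi hne
      rw [if_neg]
      intro hc
      have := congrArg List.length hc
      simp only [List.length_drop, List.length_append, Finset.mem_range] at this hi
      omega
    · simp
  · rw [Finset.sum_eq_zero fun i _ => if_neg fun (hi : w.drop i = v) =>
      h (hi ▸ List.drop_suffix i w)]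
    ext z
    exact Finsupp.single_eq_of_ne fun hz => h ⟨z, hz⟩

/-- The algebra of operators which commute with the right coaction of the tensor coalgebra. -/
def colinear (k ι : Type*) [CommRing k] : Subalgebra k (Module.End k (Full k ι)) :=
  Subalgebra.centralizer k (Set.range (dropEnd k))

lemma mem_colinear {D : Module.End k (Full k ι)} :
    D ∈ colinear k ι ↔ ∀ v x, dropEnd k v (D x) = D (dropEnd k v x) := by
  rw [colinear, Subalgebra.mem_centralizer_iff, Set.forall_mem_range]
  exact forall_congr' fun v => LinearMap.ext_iff

lemma del_mem_colinear (j : ι) : del k j ∈ colinear k ι :=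
  mem_colinear.2 fun _ _ => Finsupp.ext fun _ => rfl

lemma commutator_mem_colinear {D E : Module.End k (Full k ι)} (hD : D ∈ colinear k ι)
    (hE : E ∈ colinear k ι) : D * E - E * D ∈ colinear k ι :=
  mem_colinear.2 fun v x => by
    simp only [LinearMap.sub_apply, Module.End.mul_apply, map_sub, mem_colinear.1 hD,
      mem_colinear.1 hE]

lemma isPointwiseClosed_colinear :
    (lengthFiltration k ι).IsPointwiseClosed (Subalgebra.toSubmodule (colinear k ι)) := by
  refine fun D hD => mem_colinear.2 fun v x => ?_
  obtain ⟨N, hx⟩ := (lengthFiltration k ι).exists_mem_step x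
  obtain ⟨E, hE, hDE⟩ := hD N
  rw [hDE x hx, hDE _ (dropEnd_mem_preserving v N x hx)]
  exact mem_colinear.1 hE v x

lemma colinear_fullWord {D : Module.End k (Full k ι)} (hD : D ∈ colinear k ι) (w : List ι) :
    D (fullWord k w) =
      ∑ i ∈ Finset.range (w.length + 1), D (fullWord k (w.take i)) [] • fullWord k (w.drop i) := by
  classical
  ext z
  have h_coeff : D (fullWord k w) z = D (dropEnd k z (fullWord k w)) [] := by
    rw [← mem_colinear.1 hD, dropEnd_apply, List.nil_append]
  rw [h_coeff, dropEnd_fullWord, map_sum, Finsupp.finsetSum_apply, Finsupp.finsetSum_apply]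
  refine Finset.sum_congr rfl fun i _ => ?_
  rw [Finsupp.smul_apply, Finsupp.single_apply]
  split_ifs <;> simp

/-! ### The coalgebra endomorphism with prescribed twisted word derivatives -/

/-- Iterated twisted derivatives along a word. -/
def iterDel (D : ι → Module.End k (Full k ι)) : List ι → Module.End k (Full k ι)
  | [] => 1
  | j :: v => iterDel D v * D j

lemma iterDel_append (D : ι → Module.End k (Full k ι)) (u v : List ι) :
    iterDel D (u ++ v) = iterDel D v * iterDel D u := by
  induction u with
  | nil => simp [iterDel]
  | cons j u ih => rw [List.cons_append, iterDel, iterDel, ih, mul_assoc]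

variable {D : ι → Module.End k (Full k ι)}

lemma iterDel_mem_lowering (hD : ∀ j, D j ∈ (lengthFiltration k ι).lowering 1) (v : List ι) :
    iterDel D v ∈ (lengthFiltration k ι).lowering v.length := by
  induction v with
  | nil => exact (lengthFiltration k ι).preserving.one_mem
  | cons j v ih => exact ExhaustiveFiltration.mul_mem_lowering ih (hD j)

lemma iterDel_mem_colinear (hD : ∀ j, D j ∈ colinear k ι) (v : List ι) :
    iterDel D v ∈ colinear k ι := by
  induction v with
  | nil => exact Subalgebra.one_mem _
  | cons j v ih => exact Subalgebra.mul_mem _ ih (hD j)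

lemma iterDel_apply_eq_zero (hD : ∀ j, D j ∈ (lengthFiltration k ι).lowering 1) {n : ℕ}
    {x : Full k ι} (hx : x ∈ (lengthFiltration k ι).step n) {v : List ι} (hv : n ≤ v.length) :
    iterDel D v x = 0 :=
  ExhaustiveFiltration.apply_eq_zero_of_mem_lowering (iterDel_mem_lowering hD v)
    ((lengthFiltration k ι).monotone_step hv hx)

variable [Finite ι]

/-- The endomorphism `F` of the full tensor coalgebra such that removing the letter `j` after `F`
is the same as applying `D j` before `F`. -/
def cofree (D : ι → Module.End k (Full k ι))
    (hD : ∀ j, D j ∈ (lengthFiltration k ι).lowering 1) : Module.End k (Full k ι) where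
  toFun x := Finsupp.ofSupportFinite (fun v => iterDel D v x []) <| by
    obtain ⟨n, hn⟩ := (lengthFiltration k ι).exists_mem_step x
    refine (List.finite_length_lt ι n).subset fun v hv => lt_of_not_ge (α := ℕ) fun h => hv ?_
    simp only [iterDel_apply_eq_zero hD hn h, Finsupp.zero_apply]
  map_add' x y := Finsupp.ext fun v => by simp [Finsupp.ofSupportFinite_coe]
  map_smul' c x := Finsupp.ext fun v => by simp [Finsupp.ofSupportFinite_coe]

variable (hD : ∀ j, D j ∈ (lengthFiltration k ι).lowering 1)

lemma cofree_apply (x : Full k ι) (v : List ι) : cofree D hD x v = iterDel D v x [] := rfl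

lemma cofree_nil (x : Full k ι) : cofree D hD x [] = x [] := rfl

lemma del_cofree (j : ι) (x : Full k ι) : del k j (cofree D hD x) = cofree D hD (D j x) :=
  Finsupp.ext fun _ => rfl

lemma cofree_mem_preserving : cofree D hD ∈ (lengthFiltration k ι).preserving := fun _ x hx =>
  mem_step.2 fun v hv => by rw [cofree_apply, iterDel_apply_eq_zero hD hx hv, Finsupp.zero_apply]

lemma cofree_fullWord_append (h_colinear : ∀ j, D j ∈ colinear k ι) (w u v : List ι) :
    cofree D hD (fullWord k w) (u ++ v) = ∑ i ∈ Finset.range (w.length + 1),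
      cofree D hD (fullWord k (w.take i)) u * cofree D hD (fullWord k (w.drop i)) v := by
  simp only [cofree_apply, iterDel_append, Module.End.mul_apply]
  rw [colinear_fullWord (iterDel_mem_colinear h_colinear u) w]
  simp only [map_sum, map_smul, Finsupp.finsetSum_apply, Finsupp.smul_apply, smul_eq_mul]

lemma cofree_apply_comm {C : Module.End k (Full k ι)} {c : ι → k}
    {Q Q' : ι → Module.End k (Full k ι)} (h_nil : ∀ x, C x [] = 0)
    (hQ : ∀ j, del k j * C = Q j + c j • (C * del k j))
    (hQ' : ∀ j, D j * C = Q' j + c j • (C * D j))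
    (h_intertwine : ∀ j, Q j * cofree D hD = cofree D hD * Q' j) (x : Full k ι) :
    cofree D hD (C x) = C (cofree D hD x) := by
  obtain ⟨n, hn⟩ := (lengthFiltration k ι).exists_mem_step x
  induction n generalizing x with
  | zero =>
    rw [(lengthFiltration k ι).step_zero, Submodule.mem_bot] at hn
    simp only [hn, map_zero]
  | succ n ih =>
    refine ext_del (by rw [cofree_nil, h_nil, h_nil]) fun j => ?_
    calc del k j (cofree D hD (C x)) = cofree D hD ((D j * C) x) := del_cofree hD j (C x)
      _ = (cofree D hD * Q' j) x + c j • C (cofree D hD (D j x)) := by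
        rw [hQ', LinearMap.add_apply, map_add, LinearMap.smul_apply, map_smul,
          Module.End.mul_apply, Module.End.mul_apply, ih _ (hD j n x hn)]
      _ = (Q j + c j • (C * del k j)) (cofree D hD x) := by
        rw [← h_intertwine, LinearMap.add_apply, LinearMap.smul_apply, Module.End.mul_apply,
          Module.End.mul_apply, del_cofree]
      _ = del k j (C (cofree D hD x)) := by rw [← hQ, Module.End.mul_apply]

end full

/-! ### Grading and the shuffle product -/

section grading

variable {k ι : Type*} [CommRing k] {deg : ι → ℤ}

lemma wdeg_nil : wdeg deg [] = 0 := rfl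

lemma wdeg_cons (a : ι) (w : List ι) : wdeg deg (a :: w) = deg a + wdeg deg w := by
  simp [wdeg]

variable (deg) in
/-- The elements of a given degree. -/
def ofDeg (k : Type*) [CommRing k] (n : ℤ) : Submodule k (Full k ι) :=
  Finsupp.supported k k {w | wdeg deg w = n}

lemma mem_ofDeg {n : ℤ} {x : Full k ι} :
    x ∈ ofDeg deg k n ↔ ∀ w : List ι, wdeg deg w ≠ n → x w = 0 := Finsupp.mem_supported' k x

variable (deg) in
lemma fullWord_mem_ofDeg (w : List ι) : fullWord k w ∈ ofDeg deg k (wdeg deg w) :=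
  Finsupp.single_mem_supported k 1 rfl

variable (deg) in
/-- Operators lowering the degree by `r`. -/
def lowersDeg (r : ℤ) : Submodule k (Module.End k (Full k ι)) where
  carrier := {D | ∀ n, ∀ x ∈ ofDeg deg k n, D x ∈ ofDeg deg k (n - r)}
  add_mem' ha hb n x hx := Submodule.add_mem _ (ha n x hx) (hb n x hx)
  zero_mem' _ _ _ := Submodule.zero_mem _
  smul_mem' c _ ha n x hx := Submodule.smul_mem _ c (ha n x hx)

lemma mul_mem_lowersDeg {r s : ℤ} {D E : Module.End k (Full k ι)} (hD : D ∈ lowersDeg deg r)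
    (hE : E ∈ lowersDeg deg s) : D * E ∈ lowersDeg deg (r + s) := fun n x hx => by
  rw [add_comm, ← sub_sub]
  exact hD _ _ (hE n x hx)

lemma commutator_mem_lowersDeg {r s : ℤ} {D E : Module.End k (Full k ι)}
    (hD : D ∈ lowersDeg deg r) (hE : E ∈ lowersDeg deg s) : D * E - E * D ∈ lowersDeg deg (r + s) :=
  fun n x hx => (ofDeg deg k _).sub_mem (mul_mem_lowersDeg hD hE n x hx)
    (add_comm s r ▸ mul_mem_lowersDeg hE hD n x hx)

lemma isPointwiseClosed_lowersDeg (r : ℤ) :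
    (lengthFiltration k ι).IsPointwiseClosed (lowersDeg deg r) := fun D hD n x hx => by
  obtain ⟨N, hN⟩ := (lengthFiltration k ι).exists_mem_step x
  obtain ⟨E, hE, hDE⟩ := hD N
  rw [hDE x hN]
  exact hE n x hx

lemma del_mem_lowersDeg (j : ι) : del k j ∈ lowersDeg deg (deg j) := fun n x hx =>
  mem_ofDeg.2 fun w hw => mem_ofDeg.1 hx (j :: w) fun h => hw (by rw [← h, wdeg_cons]; ring)

lemma iterDel_mem_lowersDeg {D : ι → Module.End k (Full k ι)}
    (hD : ∀ j, D j ∈ lowersDeg deg (deg j)) (v : List ι) :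
    iterDel D v ∈ lowersDeg deg (wdeg deg v) := by
  induction v with
  | nil => intro n x hx; rwa [wdeg_nil, sub_zero]
  | cons j v ih => rw [wdeg_cons, add_comm]; exact mul_mem_lowersDeg ih (hD j)

lemma cofree_mem_lowersDeg [Finite ι] {D : ι → Module.End k (Full k ι)}
    (hD : ∀ j, D j ∈ (lengthFiltration k ι).lowering 1)
    (h_deg : ∀ j, D j ∈ lowersDeg deg (deg j)) : cofree D hD ∈ lowersDeg deg 0 := fun n x hx => by
  rw [sub_zero]
  refine mem_ofDeg.2 fun v hv => mem_ofDeg.1 (iterDel_mem_lowersDeg h_deg v n x hx) [] ?_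
  rw [wdeg_nil]
  exact fun h => hv (by linarith)

end grading

section shuffle

variable {k ι : Type*} [Field k] {deg : ι → ℤ}

lemma sgn_zero : sgn k 0 = 1 := by simp [sgn]

lemma sgn_add (m n : ℤ) : sgn k (m + n) = sgn k m * sgn k n := by
  simp [sgn, Int.negOnePow_add]

variable (deg) in
/-- The operator `w ↦ (-1)^(r |w|) w`. -/
def signOp (k : Type*) [Field k] (r : ℤ) : Module.End k (Full k ι) :=
  Finsupp.linearCombination k fun w => sgn k (r * wdeg deg w) • fullWord k w

lemma signOp_fullWord (r : ℤ) (w : List ι) :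
    signOp deg k r (fullWord k w) = sgn k (r * wdeg deg w) • fullWord k w := by
  rw [signOp, Finsupp.linearCombination_single, one_smul]

lemma signOp_apply (r : ℤ) (x : Full k ι) (w : List ι) :
    signOp deg k r x w = sgn k (r * wdeg deg w) * x w := by
  classical
  have : Finsupp.lapply w ∘ₗ signOp deg k r = sgn k (r * wdeg deg w) • Finsupp.lapply w :=
    full_hom_ext fun v => by
      simp only [LinearMap.comp_apply, signOp_fullWord, LinearMap.smul_apply, Finsupp.lapply_apply,
        Finsupp.single_apply, smul_eq_mul, map_smul]
      split_ifs with h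
      · rw [h]
      · simp
  exact LinearMap.congr_fun this x

lemma signOp_zero : signOp deg k 0 = 1 := LinearMap.ext fun x => Finsupp.ext fun w => by
  rw [signOp_apply, zero_mul, sgn_zero, one_mul, Module.End.one_apply]

lemma signOp_of_mem_ofDeg {r n : ℤ} {x : Full k ι} (hx : x ∈ ofDeg deg k n) :
    signOp deg k r x = sgn k (r * n) • x := by
  ext w
  rw [signOp_apply, Finsupp.smul_apply, smul_eq_mul]
  by_cases h : wdeg deg w = n
  · rw [h]
  · rw [mem_ofDeg.1 hx w h, mul_zero, mul_zero]

lemma map_signOp {r s : ℤ} {D : Module.End k (Full k ι)} (hD : D ∈ lowersDeg deg s)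
    (x : Full k ι) : D (signOp deg k r x) = sgn k (r * s) • signOp deg k r (D x) := by
  have : D ∘ₗ signOp deg k r = sgn k (r * s) • (signOp deg k r ∘ₗ D) := full_hom_ext fun w => by
    rw [LinearMap.comp_apply, LinearMap.smul_apply, LinearMap.comp_apply, signOp_fullWord,
      map_smul, signOp_of_mem_ofDeg (hD _ _ (fullWord_mem_ofDeg deg w)), smul_smul, ← sgn_add]
    congr 2
    ring
  exact LinearMap.congr_fun this x

lemma map_signOp_of_mem_lowersDeg_zero {r : ℤ} {D : Module.End k (Full k ι)}
    (hD : D ∈ lowersDeg deg 0) (x : Full k ι) : D (signOp deg k r x) = signOp deg k r (D x) := by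
  rw [map_signOp hD, mul_zero, sgn_zero, one_smul]

lemma signOp_mem_preserving (r : ℤ) : signOp deg k r ∈ (lengthFiltration k ι).preserving :=
  fun _ x hx => mem_step.2 fun w hw => by rw [signOp_apply, mem_step.1 hx w hw, mul_zero]

variable (deg) in
/-- The signed sum of all shuffles of two words, in the full tensor coalgebra. -/
def shuffleWordFull (k : Type*) [Field k] : List ι → List ι → Full k ι
  | [], v => fullWord k v
  | u, [] => fullWord k u
  | a :: u, b :: v =>
      consFull k a (shuffleWordFull k u (b :: v)) +
        sgn k (deg b * wdeg deg (a :: u)) • consFull k b (shuffleWordFull k (a :: u) v)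
  termination_by u v => u.length + v.length

lemma shuffleWordFull_nil_left (v : List ι) : shuffleWordFull deg k [] v = fullWord k v := by
  rw [shuffleWordFull]

lemma shuffleWordFull_nil_right (u : List ι) : shuffleWordFull deg k u [] = fullWord k u := by
  cases u <;> rw [shuffleWordFull]
  simp

lemma shuffleWordFull_cons (a b : ι) (u v : List ι) : shuffleWordFull deg k (a :: u) (b :: v) =
      consFull k a (shuffleWordFull deg k u (b :: v)) +
        sgn k (deg b * wdeg deg (a :: u)) • consFull k b (shuffleWordFull deg k (a :: u) v) := by
  rw [shuffleWordFull]

variable (deg) in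
/-- The graded shuffle product on the full tensor coalgebra. -/
def shuffleFull (k : Type*) [Field k] : Full k ι →ₗ[k] Full k ι →ₗ[k] Full k ι :=
  Finsupp.linearCombination k fun u => Finsupp.linearCombination k fun v =>
    shuffleWordFull deg k u v

lemma shuffleFull_fullWord (u v : List ι) :
    shuffleFull deg k (fullWord k u) (fullWord k v) = shuffleWordFull deg k u v := by
  rw [shuffleFull, Finsupp.linearCombination_single, one_smul, Finsupp.linearCombination_single,
    one_smul]

lemma shuffleFull_nil_left (x : Full k ι) : shuffleFull deg k (fullWord k []) x = x :=
  LinearMap.congr_fun (g := LinearMap.id) (full_hom_ext fun v => by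
    rw [shuffleFull_fullWord, shuffleWordFull_nil_left, LinearMap.id_apply]) x

lemma shuffleFull_nil_right (x : Full k ι) : shuffleFull deg k x (fullWord k []) = x :=
  LinearMap.congr_fun (f := (shuffleFull deg k).flip (fullWord k [])) (g := LinearMap.id)
    (full_hom_ext fun u => by
      rw [LinearMap.flip_apply, shuffleFull_fullWord, shuffleWordFull_nil_right,
        LinearMap.id_apply]) x

lemma shuffleFull_apply_nil (x y : Full k ι) : shuffleFull deg k x y [] = x [] * y [] := by
  classical
  have : (shuffleFull deg k).compr₂ (Finsupp.lapply []) =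
      (LinearMap.mul k k).compl₁₂ (Finsupp.lapply []) (Finsupp.lapply []) := by
    refine full_hom_ext fun u => full_hom_ext fun v => ?_
    rw [LinearMap.compr₂_apply, LinearMap.compl₁₂_apply, shuffleFull_fullWord]
    rcases u with _ | ⟨a, u⟩
    · simp [shuffleWordFull_nil_left]
    rcases v with _ | ⟨b, v⟩
    · simp [shuffleWordFull_nil_right]
    · simp [shuffleWordFull_cons, consFull_nil]
  exact LinearMap.congr_fun₂ this x y

variable (deg) in
/-- Skew derivations of the shuffle product, with sign given by the degree `r`. -/
def skewDer (k : Type*) [Field k] (r : ℤ) : Submodule k (Module.End k (Full k ι)) where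
  carrier := {D | ∀ x y, D (shuffleFull deg k x y) =
    shuffleFull deg k (D x) y + shuffleFull deg k (signOp deg k r x) (D y)}
  add_mem' ha hb x y := by
    simp only [LinearMap.add_apply, ha x y, hb x y, map_add]
    abel
  zero_mem' x y := by simp
  smul_mem' c D hD x y := by
    simp only [LinearMap.smul_apply, hD x y, map_smul, smul_add]

lemma isPointwiseClosed_skewDer (r : ℤ) :
    (lengthFiltration k ι).IsPointwiseClosed (skewDer deg k r) := fun D hD x y => by
  choose order h_order using (lengthFiltration k ι).exists_mem_step
  obtain ⟨E, hE, hDE⟩ := hD (order x ⊔ order y ⊔ order (shuffleFull deg k x y))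
  have hDE_of_le {z : Full k ι} (hz : order z ≤ _) : D z = E z :=
    hDE z ((lengthFiltration k ι).monotone_step hz (h_order z))
  rw [hDE_of_le le_sup_right, hDE_of_le (le_sup_of_le_left le_sup_left),
    hDE_of_le (le_sup_of_le_left le_sup_right)]
  exact hE x y

lemma del_shuffleWordFull_cons (j a b : ι) (u v : List ι) :
    del k j (shuffleWordFull deg k (a :: u) (b :: v)) =
      shuffleFull deg k (del k j (fullWord k (a :: u))) (fullWord k (b :: v)) +
        shuffleFull deg k (signOp deg k (deg j) (fullWord k (a :: u)))
          (del k j (fullWord k (b :: v))) := by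
  classical
  rw [shuffleWordFull_cons, map_add, map_smul, del_consFull, del_consFull, del_fullWord_cons,
    del_fullWord_cons, signOp_fullWord, map_smul, LinearMap.smul_apply]
  congr 1
  · split_ifs
    · rw [shuffleFull_fullWord]
    · simp
  · split_ifs with h
    · rw [shuffleFull_fullWord, h]
    · simp

lemma del_mem_skewDer (j : ι) : del k j ∈ skewDer deg k (deg j) := by
  intro x y
  have : (shuffleFull deg k).compr₂ (del k j) =
      (shuffleFull deg k).compl₁₂ (del k j) LinearMap.id +
        (shuffleFull deg k).compl₁₂ (signOp deg k (deg j)) (del k j) := by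
    refine full_hom_ext fun u => full_hom_ext fun v => ?_
    rw [LinearMap.compr₂_apply, LinearMap.add_apply, LinearMap.add_apply,
      LinearMap.compl₁₂_apply, LinearMap.compl₁₂_apply, LinearMap.id_apply]
    rcases u with _ | ⟨a, u⟩
    · rw [shuffleFull_nil_left, del_fullWord_nil, map_zero, LinearMap.zero_apply, zero_add,
        signOp_fullWord, wdeg_nil, mul_zero, sgn_zero, one_smul, shuffleFull_nil_left]
    rcases v with _ | ⟨b, v⟩
    · rw [shuffleFull_nil_right, shuffleFull_nil_right, del_fullWord_nil, map_zero, add_zero]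
    · rw [shuffleFull_fullWord, del_shuffleWordFull_cons]
  exact LinearMap.congr_fun₂ this x y

lemma commutator_mem_skewDer {r : ℤ} {x D : Module.End k (Full k ι)} (hx : x ∈ skewDer deg k 0)
    (h_deg : x ∈ lowersDeg deg 0) (hD : D ∈ skewDer deg k r) :
    x * D - D * x ∈ skewDer deg k r := by
  intro a b
  simp only [LinearMap.sub_apply, Module.End.mul_apply, hD a b, hx a b, map_add, hx _ _, hD _ _,
    signOp_zero, Module.End.one_apply, map_signOp_of_mem_lowersDeg_zero h_deg, map_sub]
  abel

lemma cofree_shuffleFull [Finite ι] {D : ι → Module.End k (Full k ι)}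
    (hD : ∀ j, D j ∈ (lengthFiltration k ι).lowering 1)
    (h_deg : ∀ j, D j ∈ lowersDeg deg (deg j)) (h_skew : ∀ j, D j ∈ skewDer deg k (deg j))
    (x y : Full k ι) :
    cofree D hD (shuffleFull deg k x y) = shuffleFull deg k (cofree D hD x) (cofree D hD y) := by
  obtain ⟨m, hm⟩ := (lengthFiltration k ι).exists_mem_step x
  obtain ⟨n, hn⟩ := (lengthFiltration k ι).exists_mem_step y
  have eq_zero {z : Full k ι} (hz : z ∈ (lengthFiltration k ι).step 0) : z = 0 := by
    rwa [(lengthFiltration k ι).step_zero, Submodule.mem_bot] at hz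
  induction hN : m + n generalizing m n x y with
  | zero =>
    obtain rfl : m = 0 := by omega
    simp [eq_zero hm]
  | succ N ih =>
    refine ext_del ?_ fun j => ?_
    · rw [cofree_nil, shuffleFull_apply_nil, shuffleFull_apply_nil, cofree_nil, cofree_nil]
    · rw [del_cofree, h_skew j, map_add, del_mem_skewDer, del_cofree, del_cofree,
        ← map_signOp_of_mem_lowersDeg_zero (cofree_mem_lowersDeg hD h_deg)]
      congr 1
      · cases m with
        | zero => simp [eq_zero hm]
        | succ m => exact ih _ _ m (hD j _ _ hm) n hn (by omega)
      · cases n with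
        | zero => simp [eq_zero hn]
        | succ n => exact ih _ _ m (signOp_mem_preserving _ _ _ hm) n (hD j _ _ hn) (by omega)

end shuffle

end TBar

/-! ### Comparison of the reduced and the full tensor coalgebra -/

namespace TBar

section compare

variable {k ι : Type*} [Field k] {deg : ι → ℤ} {m : List ι → (ι →₀ k)}

/-- The inclusion of the reduced into the full tensor coalgebra. -/
def emb (k ι : Type*) [Field k] : T k ι →ₗ[k] Full k ι := Finsupp.lmapDomain k k Subtype.val

/-- The projection of the full onto the reduced tensor coalgebra. -/
def res (k ι : Type*) [Field k] : Full k ι →ₗ[k] T k ι :=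
  Finsupp.lcomapDomain Subtype.val Subtype.val_injective

lemma emb_apply (x : T k ι) (w : {w : List ι // w ≠ []}) : emb k ι x w.1 = x w :=
  Finsupp.mapDomain_apply Subtype.val_injective x w

lemma emb_nil (x : T k ι) : emb k ι x [] = 0 :=
  Finsupp.mapDomain_of_notMem_range x [] (by simp)

lemma res_emb (x : T k ι) : res k ι (emb k ι x) = x := Finsupp.ext (emb_apply x)

lemma emb_injective : Function.Injective (emb k ι) := Function.LeftInverse.injective res_emb

lemma emb_res {x : Full k ι} (hx : x [] = 0) : emb k ι (res k ι x) = x := by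
  ext w
  by_cases hw : w = []
  · rw [hw, emb_nil, hx]
  · exact emb_apply (res k ι x) ⟨w, hw⟩

lemma word_nil : word k ([] : List ι) = 0 := by simp [word]

lemma emb_word {w : List ι} (hw : w ≠ []) : emb k ι (word k w) = fullWord k w := by
  rw [word_eq ⟨w, hw⟩]
  exact Finsupp.mapDomain_single

lemma res_fullWord_nil : res k ι (fullWord k []) = 0 :=
  Finsupp.ext fun w => Finsupp.single_eq_of_ne w.2

lemma res_fullWord (w : List ι) : res k ι (fullWord k w) = word k w := by
  by_cases hw : w = []
  · rw [hw, word_nil, res_fullWord_nil]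
  · rw [← emb_word hw, res_emb]

lemma cons_word {j : ι} {w : List ι} (hw : w ≠ []) : cons k j (word k w) = word k (j :: w) :=
  lift_word _ hw

lemma emb_cons (a : ι) (x : T k ι) : emb k ι (cons k a x) = consFull k a (emb k ι x) := by
  have : emb k ι ∘ₗ cons k a = consFull k a ∘ₗ emb k ι := hom_ext fun w hw => by
    rw [LinearMap.comp_apply, LinearMap.comp_apply, cons_word hw, emb_word (List.cons_ne_nil a w),
      emb_word hw, consFull_fullWord]
  exact LinearMap.congr_fun this x

/-! ### Comparison of the coproducts and of the shuffle products -/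

lemma coeff_comul_append (u v : {w : List ι // w ≠ []}) (x : T k ι) :
    LinearMap.mul' k k (TensorProduct.map (coeff k u) (coeff k v) (comul k ι x)) =
      x ⟨u.1 ++ v.1, List.append_ne_nil_of_left_ne_nil u.2 v.1⟩ := by
  classical
  have : LinearMap.mul' k k ∘ₗ TensorProduct.map (coeff k u) (coeff k v) ∘ₗ comul k ι =
      coeff k ⟨u.1 ++ v.1, List.append_ne_nil_of_left_ne_nil u.2 v.1⟩ := by
    refine hom_ext fun w hw => ?_
    simp only [LinearMap.comp_apply, comul, lift_word _ hw, map_sum, TensorProduct.map_tmul,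
      LinearMap.mul'_apply, coeff_word]
    split_ifs with h
    · subst h
      rw [Finset.sum_eq_single u.1.length]
      · simp
      · intro i hi h_ne
        rw [if_neg, zero_mul]
        intro h_take
        have := congrArg List.length h_take
        rw [List.length_take, min_eq_left (Finset.mem_range.1 hi).le] at this
        exact h_ne this
      · intro h_length
        exact absurd (by simpa using h_length) v.2
    · refine Finset.sum_eq_zero fun i _ => ?_
      rw [ite_zero_mul_ite_zero, mul_one, if_neg]
      rintro ⟨h_take, h_drop⟩
      exact h (by rw [← h_take, ← h_drop, List.take_append_drop])
  exact LinearMap.congr_fun this x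

lemma tensor_ext {z z' : T k ι ⊗[k] T k ι}
    (h : ∀ u v, LinearMap.mul' k k (TensorProduct.map (coeff k u) (coeff k v) z) =
      LinearMap.mul' k k (TensorProduct.map (coeff k u) (coeff k v) z')) : z = z' := by
  have coeff_eq (u v) (z : T k ι ⊗[k] T k ι) :
      LinearMap.mul' k k (TensorProduct.map (coeff k u) (coeff k v) z) =
        finsuppTensorFinsupp' k _ _ z (u, v) := by
    induction z with
    | zero => simp
    | tmul x y => simp [coeff]
    | add x y hx hy => simp only [map_add, hx, hy, Finsupp.add_apply]
  refine (finsuppTensorFinsupp' k _ _).injective (Finsupp.ext fun ⟨u, v⟩ => ?_)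
  rw [← coeff_eq, ← coeff_eq, h]

lemma emb_shuffleWord : ∀ u v : List ι, u ++ v ≠ [] →
    emb k ι (shuffleWord k deg u v) = shuffleWordFull deg k u v
  | [], v, h => by rw [shuffleWord, shuffleWordFull_nil_left]; exact emb_word h
  | a :: u, [], _ => by
      rw [shuffleWord, shuffleWordFull_nil_right, emb_word (List.cons_ne_nil a u)]
      exact nofun
  | a :: u, b :: v, _ => by
      rw [shuffleWord, shuffleWordFull_cons, map_add, map_smul, emb_cons, emb_cons,
        emb_shuffleWord u (b :: v) (by simp), emb_shuffleWord (a :: u) v (by simp)]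
  termination_by u v => u.length + v.length

lemma emb_shuffle (x y : T k ι) :
    emb k ι (shuffle k deg x y) = shuffleFull deg k (emb k ι x) (emb k ι y) := by
  have : (shuffle k deg).compr₂ (emb k ι) =
      (shuffleFull deg k).compl₁₂ (emb k ι) (emb k ι) := by
    refine hom_ext fun u hu => hom_ext fun v hv => ?_
    rw [LinearMap.compr₂_apply, LinearMap.compl₁₂_apply, emb_word hu, emb_word hv,
      shuffleFull_fullWord, shuffle, lift_word _ hu, lift_word _ hv,
      emb_shuffleWord _ _ (List.append_ne_nil_of_left_ne_nil hu v)]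
  exact LinearMap.congr_fun₂ this x y

/-! ### Coderivations -/

variable (deg m) in
lemma coder_word_cons (a : ι) (w : List ι) :
    coder deg m (word k (a :: w)) =
      ∑ l ∈ Finset.Icc 1 (w.length + 1), (m ((a :: w).take l)).sum
        (fun j c => c • word k (j :: (a :: w).drop l)) +
      sgn k (deg a) • cons k a (coder deg m (word k w)) := by
  rw [coder, lift_word _ (List.cons_ne_nil a w), List.length_cons, Finset.sum_range_succ',
    add_comm]
  congr 1
  · simp [wdeg_nil, sgn_zero]
  by_cases hw : w = []
  · simp [hw, word_nil]
  rw [lift_word _ hw, map_sum, Finset.smul_sum]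
  refine Finset.sum_congr rfl fun i _ => ?_
  rw [map_sum, Finset.smul_sum, Nat.add_sub_add_right]
  refine Finset.sum_congr rfl fun l _ => ?_
  rw [map_smul, List.take_succ_cons, wdeg_cons, sgn_add, mul_smul, List.drop_succ_cons,
    show i + 1 + l = (i + l) + 1 by ring, List.drop_succ_cons, map_finsuppSum]
  simp only [map_smul, List.cons_append]
  congr! 4 with j c
  rw [cons_word (by simp)]

variable (deg m) in
/-- The coderivation with Taylor coefficients `m`, extended by zero to the full tensor
coalgebra. -/
def coderFull : Module.End k (Full k ι) := emb k ι ∘ₗ coder deg m ∘ₗ res k ι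

lemma emb_coder (x : T k ι) : emb k ι (coder deg m x) = coderFull deg m (emb k ι x) := by
  rw [coderFull, LinearMap.comp_apply, LinearMap.comp_apply, res_emb]

lemma coderFull_apply_nil (x : Full k ι) : coderFull deg m x [] = 0 := emb_nil _

lemma coderFull_fullWord_nil : coderFull deg m (fullWord k []) = 0 := by
  rw [coderFull, LinearMap.comp_apply, LinearMap.comp_apply, res_fullWord_nil, map_zero, map_zero]

lemma coderFull_fullWord_cons (a : ι) (w : List ι) :
    coderFull deg m (fullWord k (a :: w)) =
      ∑ l ∈ Finset.Icc 1 (w.length + 1), (m ((a :: w).take l)).sum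
        (fun j c => c • fullWord k (j :: (a :: w).drop l)) +
      sgn k (deg a) • consFull k a (coderFull deg m (fullWord k w)) := by
  simp only [coderFull, LinearMap.comp_apply, res_fullWord]
  rw [coder_word_cons, map_add, map_smul, emb_cons, map_sum]
  simp only [map_finsuppSum, map_smul, emb_word (List.cons_ne_nil _ _)]

variable (deg m) in
lemma coderFull_fullWord_mem_step (w : List ι) :
    coderFull deg m (fullWord k w) ∈ (lengthFiltration k ι).step (w.length + 1) := by
  induction w with
  | nil => rw [coderFull_fullWord_nil]; exact Submodule.zero_mem _
  | cons a w ih =>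
    rw [coderFull_fullWord_cons]
    refine Submodule.add_mem _ (Submodule.sum_mem _ fun l hl => Submodule.sum_mem _ fun j _ =>
      Submodule.smul_mem _ _ (fullWord_mem_step ?_)) (Submodule.smul_mem _ _ (consFull_mem_step ih))
    simp only [Finset.mem_Icc, List.length_cons, List.length_drop] at hl ⊢
    omega

lemma coderFull_mem_preserving : coderFull deg m ∈ (lengthFiltration k ι).preserving :=
  fun _ _ => map_mem_of_mem_step fun w hw =>
    (lengthFiltration k ι).monotone_step hw (coderFull_fullWord_mem_step deg m w)

/-- The failure of a coderivation to commute with a word derivative is a colinear operator, hence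
determined by the Taylor coefficients of the coderivation. -/
lemma del_mul_coderFull {j : ι} {Q : Module.End k (Full k ι)} (hm : m [] = 0)
    (hQ : Q ∈ colinear k ι) (h_coeff : ∀ w, Q (fullWord k w) [] = m w j) :
    del k j * coderFull deg m = Q + sgn k (deg j) • (coderFull deg m * del k j) := by
  classical
  refine full_hom_ext fun w => ?_
  simp only [LinearMap.add_apply, Module.End.mul_apply, LinearMap.smul_apply]
  rw [colinear_fullWord hQ]
  simp only [h_coeff]
  rcases w with _ | ⟨a, w⟩
  · simp [coderFull_fullWord_nil, hm, del_fullWord_nil]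
  rw [coderFull_fullWord_cons, map_add, map_smul, del_consFull, del_fullWord_cons]
  congr 1
  · rw [Finset.range_eq_Ico, Finset.sum_eq_sum_Ico_succ_bot (by simp), List.take_zero, hm,
      map_sum, Finsupp.zero_apply, zero_smul, zero_add]
    refine Finset.sum_congr rfl fun l _ => ?_
    simp only [map_finsuppSum, map_smul, del_fullWord_cons]
    rw [Finsupp.sum, Finset.sum_eq_single j (fun i _ hi => by rw [if_neg hi, smul_zero])
      (fun hj => by rw [Finsupp.notMem_support_iff.1 hj, zero_smul]), if_pos rfl]
  · split_ifs with hj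
    · rw [hj]
    · simp

/-! ### The coalgebra endomorphism on the reduced tensor coalgebra -/

variable [Finite ι] {D : ι → Module.End k (Full k ι)}

/-- The restriction of `cofree D hD` to the reduced tensor coalgebra. -/
def cofreeRed (D : ι → Module.End k (Full k ι))
    (hD : ∀ j, D j ∈ (lengthFiltration k ι).lowering 1) : Module.End k (T k ι) :=
  res k ι ∘ₗ cofree D hD ∘ₗ emb k ι

variable (hD : ∀ j, D j ∈ (lengthFiltration k ι).lowering 1)

lemma emb_cofreeRed (x : T k ι) : emb k ι (cofreeRed D hD x) = cofree D hD (emb k ι x) :=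
  emb_res (by rw [LinearMap.comp_apply, cofree_nil, emb_nil])

lemma cofreeRed_word_apply (w : List ι) (v : {w : List ι // w ≠ []}) :
    cofreeRed D hD (word k w) v = cofree D hD (fullWord k w) v.1 := by
  by_cases hw : w = []
  · subst hw
    rw [word_nil, map_zero, cofree_apply, iterDel_apply_eq_zero hD (n := 1)
      (fullWord_mem_step (w := []) Nat.one_pos) (List.length_pos_of_ne_nil v.2)]
    rfl
  · rw [← emb_word hw, ← emb_cofreeRed, emb_apply]

lemma comul_cofreeRed (h_colinear : ∀ j, D j ∈ colinear k ι) (x : T k ι) :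
    comul k ι (cofreeRed D hD x) =
      TensorProduct.map (cofreeRed D hD) (cofreeRed D hD) (comul k ι x) := by
  have : comul k ι ∘ₗ cofreeRed D hD =
      TensorProduct.map (cofreeRed D hD) (cofreeRed D hD) ∘ₗ comul k ι := by
    refine hom_ext fun w hw => tensor_ext (k := k) (ι := ι) fun u v => ?_
    have h_last : cofree D hD (fullWord k (w.drop w.length)) v.1 = 0 := by
      rw [← cofreeRed_word_apply hD _ v, List.drop_length, word_nil, map_zero, Finsupp.zero_apply]
    rw [LinearMap.comp_apply, coeff_comul_append, cofreeRed_word_apply,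
      cofree_fullWord_append hD h_colinear, Finset.sum_range_succ, h_last, mul_zero, add_zero,
      LinearMap.comp_apply, comul, lift_word _ hw]
    simp only [map_sum, TensorProduct.map_tmul, LinearMap.mul'_apply, coeff, Finsupp.lapply_apply,
      cofreeRed_word_apply]
  exact LinearMap.congr_fun this x

end compare

end TBar

/-! ### Whitney forms: commuting the word derivatives past the codifferential -/

section

variable {k A : Type*} [CommRing k] [Ring A] [Algebra k A]

attribute [local instance] LieRing.ofAssociativeRing

lemma ad_pow_eq_sum (x y : A) (n : ℕ) :
    (LieAlgebra.ad k A x ^ n) y = ∑ p ∈ Finset.HasAntidiagonal.antidiagonal n,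
      ((-1) ^ p.1 * (n.choose p.1 : k)) • (x ^ p.2 * y * x ^ p.1) := by
  have h_comm : Commute (-LinearMap.mulRight k x) (LinearMap.mulLeft k x) :=
    (LinearMap.commute_mulLeft_right (R := k) x x).symm.neg_left
  rw [LieAlgebra.ad_eq_lmul_left_sub_lmul_right, Pi.sub_apply, sub_eq_neg_add]
  refine (LinearMap.congr_fun (h_comm.add_pow' n) y).trans ?_
  rw [LinearMap.sum_apply]
  refine Finset.sum_congr rfl fun p _ => ?_
  have h_neg : (-LinearMap.mulRight k x) ^ p.1 =
      (-1 : k) ^ p.1 • LinearMap.mulRight k (x ^ p.1) := by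
    rw [← LinearMap.pow_mulRight, ← _root_.smul_pow, neg_one_smul]
  rw [h_neg, LinearMap.pow_mulLeft, ← Nat.cast_smul_eq_nsmul k, smul_mul_assoc, smul_smul, mul_comm,
    LinearMap.smul_apply, Module.End.mul_apply, LinearMap.mulRight_apply, LinearMap.mulLeft_apply]

end

namespace TBar

attribute [local instance] LieRing.ofAssociativeRing

variable {k ι : Type*} [CommRing k]

/-- The algebra of the operators on the full tensor coalgebra which preserve the length
filtration. -/
abbrev FilteredEnd (k ι : Type*) [CommRing k] : Type _ := (lengthFiltration k ι).preserving

/-- The word derivative `del k j` as an element of the algebra `FilteredEnd k ι`. -/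
def filteredDel (k : Type*) [CommRing k] {ι : Type*} (j : ι) : FilteredEnd k ι :=
  ⟨del k j, ExhaustiveFiltration.lowering_le_preserving 1 (del_mem_lowering j)⟩

lemma filteredDel_mem_lowering (j : ι) :
    (filteredDel k j : Module.End k (Full k ι)) ∈ (lengthFiltration k ι).lowering 1 :=
  del_mem_lowering j

lemma del_pow_apply (j : ι) (n : ℕ) (x : Full k ι) (v : List ι) :
    (del k j ^ n) x v = x (List.replicate n j ++ v) := by
  induction n generalizing x with
  | zero => rfl
  | succ n ih => rw [pow_succ, Module.End.mul_apply, ih, del_apply]; rfl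

lemma ad_pow_filteredDel_apply_nil (i j : ι) (n : ℕ) (x : Full k ι) :
    ((LieAlgebra.ad k (FilteredEnd k ι) (filteredDel k i) ^ n) (filteredDel k j) :
        Module.End k (Full k ι)) x [] =
      ∑ p ∈ Finset.HasAntidiagonal.antidiagonal n, (-1) ^ p.1 * (n.choose p.1 : k) *
        x (List.replicate p.1 i ++ j :: List.replicate p.2 i) := by
  rw [ad_pow_eq_sum, AddSubmonoidClass.coe_finsetSum, LinearMap.sum_apply,
    Finsupp.finsetSum_apply]
  refine Finset.sum_congr rfl fun p _ => ?_
  change ((-1) ^ p.1 * (n.choose p.1 : k)) • (del k i ^ p.2 * del k j * del k i ^ p.1) x [] = _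
  rw [Module.End.mul_apply, Module.End.mul_apply, del_pow_apply, del_apply, del_pow_apply,
    List.append_nil, smul_eq_mul]

end TBar

namespace Whitney

open TBar ExhaustiveFiltration

attribute [local instance] LieRing.ofAssociativeRing

/-- The words with one letter `t` and all other letters `dt`: those on which the higher Taylor
coefficients do not vanish. -/
def tWord (p q : ℕ) : List Letter := List.replicate p .dt ++ .t :: List.replicate q .dt

lemma length_tWord (p q : ℕ) : (tWord p q).length = p + q + 1 := by simp [tWord, add_assoc]

lemma idxOf_tWord (p q : ℕ) : (tWord p q).idxOf .t = p := by
  rw [tWord, List.idxOf_append_of_notMem (by simp)]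
  simp

lemma tWord_inj {p q p' q' : ℕ} : tWord p q = tWord p' q' ↔ p = p' ∧ q = q' := by
  refine ⟨fun h => ?_, fun ⟨hp, hq⟩ => by rw [hp, hq]⟩
  have h_idx := congrArg (List.idxOf Letter.t) h
  have h_length := congrArg List.length h
  rw [idxOf_tWord, idxOf_tWord] at h_idx
  rw [length_tWord, length_tWord] at h_length
  omega

lemma one_notMem_tWord (p q : ℕ) : Letter.one ∉ tWord p q := by simp [tWord]

lemma count_t_tWord (p q : ℕ) : (tWord p q).count .t = 1 := by
  simp [tWord, List.count_replicate]

lemma eq_replicate_dt {w : List Letter} (h_one : Letter.one ∉ w) (h_count : w.count .t = 0) :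
    w = List.replicate w.length .dt := by
  refine List.eq_replicate_iff.2 ⟨rfl, fun b hb => ?_⟩
  cases b with
  | one => exact absurd hb h_one
  | t => exact absurd hb (List.count_eq_zero.1 h_count)
  | dt => rfl

lemma exists_eq_tWord {w : List Letter} (h_one : Letter.one ∉ w) (h_count : w.count .t = 1) :
    ∃ p q, w = tWord p q := by
  induction w with
  | nil => simp at h_count
  | cons a w ih =>
    rw [List.mem_cons, not_or] at h_one
    cases a with
    | one => exact absurd rfl h_one.1
    | t =>
      rw [List.count_cons_self, Nat.add_eq_right] at h_count
      exact ⟨0, w.length, congrArg (Letter.t :: ·) (eq_replicate_dt h_one.2 h_count)⟩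
    | dt =>
      rw [List.count_cons_of_ne (by simp)] at h_count
      obtain ⟨p, q, rfl⟩ := ih h_one.2 h_count
      exact ⟨p + 1, q, rfl⟩

section

variable {k : Type*} [Field k]

/-- The power series `f` in the commutator with the word derivative `del k dt`, applied to the word
derivative `del k t`. The Taylor coefficients of the codifferential are of this form, and so are
those of its endomorphisms. -/
def delSeries (f : PowerSeries k) : FilteredEnd k Letter :=
  adSeries (filteredDel_mem_lowering Letter.dt) f (filteredDel k .t)

lemma delSeries_fullWord_nil (f : PowerSeries k) (w : List Letter) :
    (delSeries f : Module.End k (Full k Letter)) (fullWord k w) [] =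
      ∑ n ∈ Finset.range (w.length + 1), ∑ p ∈ Finset.HasAntidiagonal.antidiagonal n,
        if w = tWord p.1 p.2 then PowerSeries.coeff n f * ((-1) ^ p.1 * (n.choose p.1 : k))
        else 0 := by
  rw [delSeries, adSeries_apply_of_mem_step _ f _ (fullWord_mem_step (Nat.lt_succ_self _)),
    Finsupp.finsetSum_apply]
  refine Finset.sum_congr rfl fun n _ => ?_
  rw [Finsupp.smul_apply, ad_pow_filteredDel_apply_nil, smul_eq_mul, Finset.mul_sum]
  refine Finset.sum_congr rfl fun p _ => ?_
  rw [fullWord, Finsupp.single_apply, tWord]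
  split_ifs <;> simp

lemma delSeries_fullWord_tWord_nil (f : PowerSeries k) (p q : ℕ) :
    (delSeries f : Module.End k (Full k Letter)) (fullWord k (tWord p q)) [] =
      PowerSeries.coeff (p + q) f * ((-1) ^ p * ((p + q).choose p : k)) := by
  have h_outside {n : ℕ} (hn : n ≠ p + q) : ∀ x ∈ Finset.HasAntidiagonal.antidiagonal n,
      ¬ tWord p q = tWord x.1 x.2 := fun x hx h => by
    rw [Finset.HasAntidiagonal.mem_antidiagonal] at hx
    rw [tWord_inj] at h
    omega
  rw [delSeries_fullWord_nil, Finset.sum_eq_single (p + q), Finset.sum_eq_single (p, q),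
    if_pos rfl]
  · exact fun x _ hx => if_neg fun h => hx (Prod.ext (tWord_inj.1 h).1 (tWord_inj.1 h).2).symm
  · simp
  · exact fun n _ hn => Finset.sum_eq_zero fun x hx => if_neg (h_outside hn x hx)
  · simp [length_tWord]

lemma delSeries_fullWord_nil_eq_zero (f : PowerSeries k) {w : List Letter}
    (hw : ¬ (Letter.one ∉ w ∧ w.count .t = 1)) :
    (delSeries f : Module.End k (Full k Letter)) (fullWord k w) [] = 0 := by
  rw [delSeries_fullWord_nil]
  refine Finset.sum_eq_zero fun n _ => Finset.sum_eq_zero fun p _ => if_neg ?_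
  rintro rfl
  exact hw ⟨one_notMem_tWord _ _, count_t_tWord _ _⟩

lemma taylor_cons_cons_cons (a b c : Letter) (w : List Letter) :
    taylor k (a :: b :: c :: w) =
      if Letter.one ∉ (a :: b :: c :: w) ∧ (a :: b :: c :: w).count Letter.t = 1 then
        Finsupp.single .dt
          ((-1) ^ ((a :: b :: c :: w).idxOf Letter.t + 1) *
            (((a :: b :: c :: w).length - 1).choose ((a :: b :: c :: w).idxOf Letter.t) : k) *
            ((_root_.bernoulli ((a :: b :: c :: w).length - 1) : ℚ) : k) /
              (((a :: b :: c :: w).length - 1).factorial : k))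
      else 0 := by
  cases a <;> cases b <;> rfl

lemma taylor_one (w : List Letter) :
    taylor k w .one = if w = [.one, .one] then 1 else 0 := by
  rcases w with _ | ⟨a, _ | ⟨b, _ | ⟨c, w⟩⟩⟩
  · simp [taylor]
  · cases a <;> simp [taylor]
  · cases a <;> cases b <;> simp [taylor]
  · rw [taylor_cons_cons_cons]
    split_ifs <;> simp_all

lemma taylor_t (w : List Letter) :
    taylor k w .t = (if w = [.one, .t] then 1 else 0) + (if w = [.t, .one] then 1 else 0) +
      (if w = [.t, .t] then 1 else 0) := by
  rcases w with _ | ⟨a, _ | ⟨b, _ | ⟨c, w⟩⟩⟩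
  · simp [taylor]
  · cases a <;> simp [taylor]
  · cases a <;> cases b <;> simp [taylor]
  · rw [taylor_cons_cons_cons]
    split_ifs <;> simp_all

lemma taylor_of_count_t_eq_one {w : List Letter} (h_one : Letter.one ∉ w)
    (h_count : w.count .t = 1) : taylor k w =
      Finsupp.single .dt ((-1) ^ (w.idxOf Letter.t + 1) *
        ((w.length - 1).choose (w.idxOf Letter.t) : k) *
          ((_root_.bernoulli (w.length - 1) : ℚ) : k) / ((w.length - 1).factorial : k)) := by
  rcases w with _ | ⟨a, _ | ⟨b, _ | ⟨c, w⟩⟩⟩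
  · simp at h_count
  · cases a <;> simp_all [taylor]
  · cases a <;> cases b <;> simp_all [taylor]
  · rw [taylor_cons_cons_cons, if_pos ⟨h_one, h_count⟩]

variable [CharZero k]

lemma coeff_bernoulliPowerSeries (n : ℕ) : PowerSeries.coeff n (bernoulliPowerSeries k) =
    ((_root_.bernoulli n : ℚ) : k) / (n.factorial : k) := by
  simp [bernoulliPowerSeries]

lemma taylor_tWord (p q : ℕ) : taylor k (tWord p q) =
    -Finsupp.single .dt (PowerSeries.coeff (p + q) (bernoulliPowerSeries k) *
      ((-1) ^ p * ((p + q).choose p : k))) := by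
  rw [taylor_of_count_t_eq_one (one_notMem_tWord p q) (count_t_tWord p q), length_tWord,
    idxOf_tWord, ← Finsupp.single_neg, coeff_bernoulliPowerSeries, Nat.add_sub_cancel]
  congr 1
  ring

lemma taylor_dt (w : List Letter) :
    taylor k w .dt = (if w = [.one, .dt] then 1 else 0) - (if w = [.dt, .one] then 1 else 0) -
      (delSeries (bernoulliPowerSeries k) : Module.End k (Full k Letter)) (fullWord k w) [] := by
  by_cases hw : Letter.one ∉ w ∧ w.count .t = 1
  · obtain ⟨p, q, rfl⟩ := exists_eq_tWord hw.1 hw.2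
    rw [delSeries_fullWord_tWord_nil, taylor_tWord, if_neg, if_neg]
    · simp
    · exact fun h => hw.1 (by simp [h])
    · exact fun h => hw.1 (by simp [h])
  · rw [delSeries_fullWord_nil_eq_zero _ hw]
    rcases w with _ | ⟨a, _ | ⟨b, _ | ⟨c, w⟩⟩⟩
    · simp [taylor]
    · cases a <;> simp_all [taylor]
    · cases a <;> cases b <;> simp_all [taylor]
    · rw [taylor_cons_cons_cons, if_neg hw]
      simp

end

end Whitney

/-! ### The morphism with prescribed linear part -/

namespace Whitney

open TBar ExhaustiveFiltration

attribute [local instance] LieRing.ofAssociativeRing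

section rules

variable {k V : Type*} [Field k] [AddCommGroup V] [Module k V]
  {F : ExhaustiveFiltration k V} {D : Letter → F.preserving}

lemma sgn_neg_one : sgn k (-1) = -1 := by simp [sgn]

variable [CharZero k]

/-- The right hand side of the commutation rules
`D j * Q = failure D hD j + sgn k (sdeg j) • (Q * D j)` satisfied by the word derivatives `D` and
the codifferential `Q` of the Whitney forms. -/
def failure (D : Letter → F.preserving) (hD : (D .dt : Module.End k V) ∈ F.lowering 1) :
    Letter → F.preserving
  | .one => D .one * D .one
  | .t => D .one * D .t + D .t * D .one + D .t * D .t
  | .dt => D .dt * D .one - D .one * D .dt - adSeries hD (bernoulliPowerSeries k) (D .t)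

lemma failure_mul_eq_mul_failure {D' : Letter → F.preserving} {hD hD'} {φ : F.preserving}
    (hφ : ∀ j, D j * φ = φ * D' j) (j : Letter) :
    failure D hD j * φ = φ * failure D' hD' j := by
  have h_mul (i j : Letter) : D i * D j * φ = φ * (D' i * D' j) := by
    rw [mul_assoc, hφ, ← mul_assoc, hφ, mul_assoc]
  cases j with
  | one => exact h_mul _ _
  | t => simp only [failure, add_mul, mul_add, h_mul]
  | dt => simp only [failure, sub_mul, mul_sub, h_mul,
      adSeries_mul_eq_mul_adSeries hD hD' (hφ .dt) (hφ .t)]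

variable (hD : (D .dt : Module.End k V) ∈ F.lowering 1)

/-- The operators obtained from the word derivatives `D` by an affine change of the coordinate `t`
with `t ↦ (s' - s) t + s` and `dt ↦ (s' - s) dt` to first order. -/
def twist (s s' : k) : Letter → F.preserving
  | .one => D .one + gaugeFlow hD (D .t) s
  | .t => gaugeFlow hD (D .t) s' - gaugeFlow hD (D .t) s
  | .dt => (s' - s) • D .dt

lemma twist_mem {P : ℤ → Submodule k (Module.End k V)} (hP : F.IsPointwiseClosed (P (-1)))
    (h_comm : ∀ E ∈ P (-1), (D .dt : Module.End k V) * E - E * D .dt ∈ P (-1))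
    (h_mem : ∀ j, (D j : Module.End k V) ∈ P (sdeg j)) (s s' : k) (j : Letter) :
    (twist hD s s' j : Module.End k V) ∈ P (sdeg j) := by
  have h_flow (s : k) : (gaugeFlow hD (D .t) s : Module.End k V) ∈ P (-1) :=
    adSeries_mem hD _ hP h_comm (h_mem .t)
  cases j with
  | one => exact (P (-1)).add_mem (h_mem .one) (h_flow s)
  | t => exact (P (-1)).sub_mem (h_flow s') (h_flow s)
  | dt => exact (P 0).smul_mem _ (h_mem .dt)

lemma twist_mem_lowering (h_mem : ∀ j, (D j : Module.End k V) ∈ F.lowering 1) (s s' : k)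
    (j : Letter) : (twist hD s s' j : Module.End k V) ∈ F.lowering 1 :=
  twist_mem hD (P := fun _ => F.lowering 1) (isPointwiseClosed_lowering 1)
    (fun _ hE => F.lowering_antitone (Nat.le_succ 1) (commutator_mem_lowering hD hE)) h_mem s s' j

lemma failure_mem {A : Subalgebra k (Module.End k V)}
    (hA : F.IsPointwiseClosed (Subalgebra.toSubmodule A)) (h_mem : ∀ j, (D j : Module.End k V) ∈ A)
    (j : Letter) : (failure D hD j : Module.End k V) ∈ A := by
  have h_mul (i j : Letter) : (D i * D j : Module.End k V) ∈ A := A.mul_mem (h_mem i) (h_mem j)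
  cases j with
  | one => exact h_mul _ _
  | t => exact A.add_mem (A.add_mem (h_mul _ _) (h_mul _ _)) (h_mul _ _)
  | dt =>
    exact A.sub_mem (A.sub_mem (h_mul _ _) (h_mul _ _)) <| adSeries_mem hD _ hA
      (fun _ hE => A.sub_mem (A.mul_mem (h_mem .dt) hE) (A.mul_mem hE (h_mem .dt))) (h_mem .t)

lemma twist_dt_mem_lowering (s s' : k) :
    (twist hD s s' .dt : Module.End k V) ∈ F.lowering 1 :=
  (F.lowering 1).smul_mem _ hD

lemma adSeries_twist_dt (s s' : k) :
    adSeries (twist_dt_mem_lowering hD s s') (bernoulliPowerSeries k) (twist hD s s' .t) =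
      (s' - s) • (adSeries hD (bernoulliPowerSeries k) (D .t) +
        ⁅D .dt, gaugeFlow hD (D .t) s⁆) := by
  have h_smul := adSeries_smul hD (twist_dt_mem_lowering hD s s') (bernoulliPowerSeries k)
  refine (LinearMap.congr_fun h_smul _).trans ?_
  simp only [twist, gaugeFlow]
  rw [← LinearMap.sub_apply, ← map_sub, ← Module.End.mul_apply, ← map_mul,
    rescale_bernoulliPowerSeries_mul_gaugeSeries_sub, ← PowerSeries.smul_eq_C_mul, map_smul,
    map_add, map_mul, LinearMap.smul_apply, LinearMap.add_apply, Module.End.mul_apply, adSeries_X]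

variable {Q : F.preserving}
  (hQ : ∀ j, D j * Q = failure D hD j + sgn k (sdeg j) • (Q * D j))

include hQ

/-- `D t` is a Maurer–Cartan element for the differential `Q - D one`, gauge equivalent to zero
through `D dt`, and hence so are all elements of its gauge flow. -/
lemma gaugeFlow_mul (s : k) : gaugeFlow hD (D .t) s * Q =
    D .one * gaugeFlow hD (D .t) s + gaugeFlow hD (D .t) s * D .one +
      gaugeFlow hD (D .t) s * gaugeFlow hD (D .t) s - Q * gaugeFlow hD (D .t) s := by
  have ht : D .t * Q = D .one * D .t + D .t * D .one + D .t * D .t - Q * D .t := by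
    simpa only [failure, sdeg, sgn_neg_one, neg_smul, one_smul, ← sub_eq_add_neg] using hQ .t
  have hdt : D .dt * Q = D .dt * D .one - D .one * D .dt -
      adSeries hD (bernoulliPowerSeries k) (D .t) + Q * D .dt := by
    simpa only [failure, sdeg, sgn_zero, one_smul] using hQ .dt
  have h_flow := sub_gaugeFlow_mul_self hD (d := Q - D .one) (τ := D .t)
    (by rw [Ring.lie_def, mul_sub, sub_mul, hdt]; abel)
    (by simp only [mul_sub, sub_mul, ht]; abel) s
  generalize gaugeFlow hD (D .t) s = g at h_flow ⊢
  rw [← sub_eq_zero] at h_flow ⊢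
  rw [← neg_eq_zero, ← h_flow]
  noncomm_ring

lemma twist_mul (s s' : k) (j : Letter) : twist hD s s' j * Q =
    failure (twist hD s s') (twist_dt_mem_lowering hD s s') j +
      sgn k (sdeg j) • (Q * twist hD s s' j) := by
  have h_flow (s : k) := gaugeFlow_mul hD hQ s
  have h_one : D .one * Q = D .one * D .one - Q * D .one := by
    simpa only [failure, sdeg, sgn_neg_one, neg_smul, one_smul, ← sub_eq_add_neg] using hQ .one
  have h_dt : D .dt * Q = D .dt * D .one - D .one * D .dt -
      adSeries hD (bernoulliPowerSeries k) (D .t) + Q * D .dt := by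
    simpa only [failure, sdeg, sgn_zero, one_smul] using hQ .dt
  cases j with
  | one =>
    simp only [sdeg, sgn_neg_one, neg_smul, one_smul, failure, twist, add_mul, h_one, h_flow]
    noncomm_ring
  | t =>
    simp only [sdeg, sgn_neg_one, neg_smul, one_smul, failure, twist, sub_mul, h_flow]
    noncomm_ring
  | dt =>
    rw [failure, adSeries_twist_dt hD]
    simp only [sdeg, sgn_zero, one_smul, twist, smul_mul_assoc, mul_smul_comm, ← smul_sub,
      ← smul_add, h_dt, Ring.lie_def]
    congr 1
    noncomm_ring

end rules

section morphism

variable {k : Type*} [Field k]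

lemma filteredDel_mul_fullWord_nil (i j : Letter) (w : List Letter) :
    (filteredDel k i * filteredDel k j : Module.End k (Full k Letter)) (fullWord k w) [] =
      if w = [j, i] then 1 else 0 := by
  change fullWord k w [j, i] = _
  rw [fullWord, Finsupp.single_apply]

variable (k) in
/-- The codifferential of the Whitney forms on the full tensor coalgebra. -/
def codiff : FilteredEnd k Letter := ⟨coderFull sdeg (taylor k), coderFull_mem_preserving⟩

variable [CharZero k]

variable (k) in
/-- The right hand side of the commutation rules of the word derivatives with `codiff`. -/
abbrev delFailure : Letter → FilteredEnd k Letter :=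
  failure (filteredDel k) (filteredDel_mem_lowering Letter.dt)

lemma delFailure_mem_colinear (j : Letter) :
    (delFailure k j : Module.End k (Full k Letter)) ∈ colinear k Letter :=
  failure_mem _ isPointwiseClosed_colinear del_mem_colinear j

lemma delFailure_fullWord_nil (j : Letter) (w : List Letter) :
    (delFailure k j : Module.End k (Full k Letter)) (fullWord k w) [] = taylor k w j := by
  cases j with
  | one => rw [taylor_one, ← filteredDel_mul_fullWord_nil]; rfl
  | t =>
    rw [taylor_t, ← filteredDel_mul_fullWord_nil, ← filteredDel_mul_fullWord_nil,
      ← filteredDel_mul_fullWord_nil, add_comm (DFunLike.coe _ [])]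
    rfl
  | dt =>
    rw [taylor_dt, ← filteredDel_mul_fullWord_nil, ← filteredDel_mul_fullWord_nil]
    rfl

lemma filteredDel_mul_codiff (j : Letter) : filteredDel k j * codiff k =
    delFailure k j + sgn k (sdeg j) • (codiff k * filteredDel k j) :=
  Subtype.ext <| del_mul_coderFull rfl (delFailure_mem_colinear j) (delFailure_fullWord_nil j)

/-- The operators `D` for which `cofree D` has linear part `t ↦ (s' - s) t + s`. -/
def twistedDel (s s' : k) : Letter → FilteredEnd k Letter :=
  twist (filteredDel_mem_lowering Letter.dt) s s'

lemma twistedDel_mem_lowering (s s' : k) (j : Letter) :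
    (twistedDel s s' j : Module.End k (Full k Letter)) ∈ (lengthFiltration k Letter).lowering 1 :=
  twist_mem_lowering _ del_mem_lowering s s' j

lemma twistedDel_mem_colinear (s s' : k) (j : Letter) :
    (twistedDel s s' j : Module.End k (Full k Letter)) ∈ colinear k Letter :=
  twist_mem (P := fun _ => Subalgebra.toSubmodule (colinear k Letter))
    (filteredDel_mem_lowering Letter.dt) isPointwiseClosed_colinear
    (fun _ => commutator_mem_colinear (del_mem_colinear Letter.dt)) del_mem_colinear s s' j

lemma twistedDel_mem_lowersDeg (s s' : k) (j : Letter) :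
    (twistedDel s s' j : Module.End k (Full k Letter)) ∈ lowersDeg sdeg (sdeg j) :=
  twist_mem (P := lowersDeg sdeg) (filteredDel_mem_lowering Letter.dt)
    (isPointwiseClosed_lowersDeg _)
    (fun _ => commutator_mem_lowersDeg (r := 0) (s := -1) (del_mem_lowersDeg Letter.dt))
    del_mem_lowersDeg s s' j

lemma twistedDel_mem_skewDer (s s' : k) (j : Letter) :
    (twistedDel s s' j : Module.End k (Full k Letter)) ∈ skewDer sdeg k (sdeg j) :=
  twist_mem (P := skewDer sdeg k) (filteredDel_mem_lowering Letter.dt) (isPointwiseClosed_skewDer _)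
    (fun _ => commutator_mem_skewDer (del_mem_skewDer Letter.dt) (del_mem_lowersDeg Letter.dt))
    del_mem_skewDer s s' j

variable (k) in
/-- The unital morphism with linear part `t ↦ (s' - s) t + s`, `dt ↦ (s' - s) dt`. -/
def affineMorphism (s s' : k) : Module.End k (T k Letter) :=
  cofreeRed (fun j => twistedDel s s' j) (twistedDel_mem_lowering s s')

lemma proj_affineMorphism (s s' : k) (w : List Letter) (j : Letter) :
    proj k Letter (affineMorphism k s s' (word k w)) j =
      (twistedDel s s' j : Module.End k (Full k Letter)) (fullWord k w) [] := by
  rw [proj_apply, affineMorphism, cofreeRed_word_apply]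
  rfl

lemma twistedDel_fullWord_nil_of_one_mem (s s' : k) {w : List Letter} (hw : Letter.one ∈ w)
    (j : Letter) : (twistedDel s s' j : Module.End k (Full k Letter)) (fullWord k w) [] =
      if w = [.one] ∧ j = .one then 1 else 0 := by
  have h_flow (s : k) : (delSeries (gaugeSeries k s) : Module.End k (Full k Letter))
      (fullWord k w) [] = 0 := delSeries_fullWord_nil_eq_zero _ fun h => h.1 hw
  cases j with
  | one =>
    change fullWord k w [.one] +
      (delSeries (gaugeSeries k s) : Module.End k _) (fullWord k w) [] = _
    rw [h_flow, add_zero, fullWord, Finsupp.single_apply]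
    simp
  | t =>
    change (delSeries (gaugeSeries k s') : Module.End k _) (fullWord k w) [] -
      (delSeries (gaugeSeries k s) : Module.End k _) (fullWord k w) [] = _
    rw [h_flow, h_flow]
    simp
  | dt =>
    change (s' - s) • fullWord k w [.dt] = _
    rw [fullWord, Finsupp.single_apply, if_neg (by rintro rfl; simp at hw)]
    simp

lemma twistedDel_mul_codiff (s s' : k) (j : Letter) : twistedDel s s' j * codiff k =
    failure (twistedDel s s') (twistedDel_mem_lowering s s' .dt) j +
      sgn k (sdeg j) • (codiff k * twistedDel s s' j) :=
  twist_mul _ filteredDel_mul_codiff s s' j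

lemma cofree_twistedDel_codiff (s s' : k) (x : Full k Letter) :
    cofree (fun j => (twistedDel s s' j : Module.End k (Full k Letter)))
        (twistedDel_mem_lowering s s') (coderFull sdeg (taylor k) x) =
      coderFull sdeg (taylor k) (cofree (fun j => twistedDel s s' j)
        (twistedDel_mem_lowering s s') x) := by
  let φ : FilteredEnd k Letter := ⟨_, cofree_mem_preserving (twistedDel_mem_lowering s s')⟩
  have h_cofree (j : Letter) : filteredDel k j * φ = φ * twistedDel s s' j :=
    Subtype.ext (LinearMap.ext fun x => del_cofree (twistedDel_mem_lowering s s') j x)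
  exact cofree_apply_comm (twistedDel_mem_lowering s s') (Q := fun j => delFailure k j)
    (Q' := fun j => failure (twistedDel s s') (twistedDel_mem_lowering s s' .dt) j)
    coderFull_apply_nil
    (fun j => congrArg Subtype.val (filteredDel_mul_codiff j))
    (fun j => congrArg Subtype.val (twistedDel_mul_codiff s s' j))
    (fun j => congrArg Subtype.val (failure_mul_eq_mul_failure h_cofree j)) x

lemma affineMorphism_isUnitalCInf (s s' : k) :
    IsUnitalCInf sdeg (taylor k) Letter.one (affineMorphism k s s') where
  degree w v h := by
    by_contra h_deg
    rw [affineMorphism, cofreeRed_word_apply] at h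
    exact h (mem_ofDeg.1 (cofree_mem_lowersDeg _ (twistedDel_mem_lowersDeg s s') _ _
      (fullWord_mem_ofDeg sdeg w.1)) v.1 (by rwa [sub_zero]))
  comul := comul_cofreeRed _ (twistedDel_mem_colinear s s')
  shuffle x y := emb_injective <| by
    rw [affineMorphism, emb_cofreeRed, emb_shuffle, emb_shuffle, emb_cofreeRed, emb_cofreeRed,
      cofree_shuffleFull _ (twistedDel_mem_lowersDeg s s') (twistedDel_mem_skewDer s s')]
  coder x := emb_injective <| by
    rw [affineMorphism, emb_cofreeRed, emb_coder, emb_coder, emb_cofreeRed,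
      cofree_twistedDel_codiff]
  unit_one := Finsupp.ext fun j => by
    rw [proj_affineMorphism, twistedDel_fullWord_nil_of_one_mem s s' (by simp),
      Finsupp.single_apply]
    simp [eq_comm]
  unit_zero w hw h := Finsupp.ext fun j => by
    rw [proj_affineMorphism, twistedDel_fullWord_nil_of_one_mem s s' h, if_neg]
    · rfl
    · rintro ⟨rfl, -⟩
      simp at hw

lemma delSeries_gaugeSeries_fullWord_singleton (s : k) (j : Letter) :
    (delSeries (gaugeSeries k s) : Module.End k (Full k Letter)) (fullWord k [j]) [] =
      if j = .t then s else 0 := by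
  rw [delSeries_fullWord_nil]
  cases j <;>
    simp [tWord, coeff_zero_gaugeSeries, Finset.sum_range_succ, Finset.Nat.antidiagonal_succ]

lemma proj_affineMorphism_t (s s' : k) :
    proj k Letter (affineMorphism k s s' (word k [.t])) =
      Finsupp.single .t (s' - s) + Finsupp.single .one s := by
  have h_flow (s : k) : (delSeries (gaugeSeries k s) : Module.End k (Full k Letter))
      (fullWord k [.t]) [] = s := delSeries_gaugeSeries_fullWord_singleton s .t
  ext j
  rw [proj_affineMorphism]
  cases j with
  | one =>
    change fullWord k [.t] [Letter.one] +
      (delSeries (gaugeSeries k s) : Module.End k (Full k Letter)) _ [] = _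
    rw [h_flow]
    simp
  | t =>
    change (delSeries (gaugeSeries k s') : Module.End k (Full k Letter)) _ [] -
      (delSeries (gaugeSeries k s) : Module.End k (Full k Letter)) _ [] = _
    rw [h_flow, h_flow]
    simp
  | dt =>
    change (s' - s) • fullWord k [.t] [Letter.dt] = _
    simp

end morphism

end Whitney

/-! ### Uniqueness of the morphism with given linear part -/

namespace TBar

variable {k ι : Type*} [Field k] {deg : ι → ℤ}

lemma apply_word_eq_of_proj_eq {F F' : Module.End k (T k ι)}
    (hF : ∀ x, comul k ι (F x) = TensorProduct.map F F (comul k ι x))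
    (hF' : ∀ x, comul k ι (F' x) = TensorProduct.map F' F' (comul k ι x)) {w : List ι}
    (h_short : ∀ v : List ι, v.length < w.length → F (word k v) = F' (word k v))
    (h_proj : proj k ι (F (word k w)) = proj k ι (F' (word k w))) :
    F (word k w) = F' (word k w) := by
  by_cases hw : w = []
  · rw [hw, word_nil, map_zero, map_zero]
  ext ⟨v, hv⟩
  obtain ⟨j, v, rfl⟩ := List.exists_cons_of_ne_nil hv
  by_cases hv' : v = []
  · subst hv'
    rw [← proj_apply, ← proj_apply, h_proj]
  rw [← coeff_comul j ⟨v, hv'⟩, ← coeff_comul j ⟨v, hv'⟩, hF, hF', comul, lift_word _ hw]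
  simp only [map_sum, TensorProduct.map_tmul]
  refine Finset.sum_congr rfl fun i hi => ?_
  rw [Finset.mem_range] at hi
  rcases Nat.eq_zero_or_pos i with rfl | h_pos
  · simp [word_nil]
  · rw [h_short _ (by rw [List.length_take]; omega), h_short _ (by rw [List.length_drop]; omega)]

lemma shuffle_word {u v : List ι} (hu : u ≠ []) (hv : v ≠ []) :
    shuffle k deg (word k u) (word k v) = shuffleWord k deg u v := by
  rw [shuffle, lift_word _ hu, lift_word _ hv]

lemma proj_shuffle (x y : T k ι) : proj k ι (shuffle k deg x y) = 0 := by
  ext j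
  rw [proj_apply, ← emb_apply, emb_shuffle, ← del_apply, del_mem_skewDer (deg := deg) j,
    Finsupp.add_apply, shuffleFull_apply_nil, shuffleFull_apply_nil, emb_nil, mul_zero,
    signOp_apply, emb_nil, mul_zero, zero_mul, add_zero, Finsupp.zero_apply]

lemma map_coder_word_cons {M : Type*} [AddCommGroup M] [Module k M] {m : List ι → (ι →₀ k)}
    {G : T k ι →ₗ[k] M} {a : ι} {w : List ι}
    (hG : ∀ v : List ι, v.length ≤ w.length → G (word k v) = 0) :
    G (coder deg m (word k (a :: w))) = (m [a]).sum (fun j c => c • G (word k (j :: w))) +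
      sgn k (deg a) • G (cons k a (coder deg m (word k w))) := by
  rw [coder_word_cons, map_add, map_smul, map_sum, Finset.sum_eq_single_of_mem 1 (by simp)]
  · rw [map_finsuppSum]
    simp only [map_smul, List.take_succ_cons, List.take_zero, List.drop_succ_cons, List.drop_zero]
  · intro l hl h_ne
    rw [Finset.mem_Icc] at hl
    rw [map_finsuppSum]
    refine Finset.sum_eq_zero fun j _ => ?_
    simp only [map_smul]
    rw [hG _ (by simp only [List.length_cons, List.length_drop]; omega), smul_zero]

end TBar

namespace Whitney

open TBar

variable {k : Type*} [Field k]

lemma shuffleWord_dt_cons (b : Letter) (v : List Letter) :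
    shuffleWord k sdeg [.dt] (b :: v) =
      word k (.dt :: b :: v) + cons k b (shuffleWord k sdeg [.dt] v) := by
  have h_deg : wdeg sdeg [.dt] = 0 := rfl
  rw [shuffleWord, shuffleWord, cons_word (by simp), h_deg, mul_zero, sgn_zero, one_smul]

lemma shuffleWord_dt_replicate (n : ℕ) : shuffleWord k sdeg [.dt] (List.replicate n .dt) =
    (n + 1 : k) • word k (List.replicate (n + 1) .dt) := by
  induction n with
  | zero => simp [shuffleWord]
  | succ n ih =>
    rw [List.replicate_succ, shuffleWord_dt_cons, ih, map_smul, cons_word (by simp),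
      ← List.replicate_succ, ← List.replicate_succ]
    push_cast
    rw [add_smul ((n : k) + 1), one_smul, add_comm]

lemma shuffleWord_dt_tWord (p q : ℕ) : shuffleWord k sdeg [.dt] (tWord p q) =
    (p + 1 : k) • word k (tWord (p + 1) q) + (q + 1 : k) • word k (tWord p (q + 1)) := by
  induction p with
  | zero =>
    rw [tWord, List.replicate_zero, List.nil_append, shuffleWord_dt_cons,
      shuffleWord_dt_replicate, map_smul, cons_word (by simp)]
    simp [tWord]
  | succ p ih =>
    have h_cons (p q : ℕ) : tWord (p + 1) q = .dt :: tWord p q := rfl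
    have h_ne (p q : ℕ) : tWord p q ≠ [] := List.append_ne_nil_of_right_ne_nil _ (by simp)
    rw [h_cons, shuffleWord_dt_cons, ih, map_add, map_smul, map_smul, cons_word (h_ne _ _),
      cons_word (h_ne _ _), ← add_assoc, ← h_cons, ← h_cons, ← h_cons]
    push_cast
    rw [add_smul ((p : k) + 1), one_smul, add_comm (word k _)]

section shuffles

variable {M : Type*} [AddCommGroup M] [Module k M] {G : T k Letter →ₗ[k] M}
  (hG : ∀ x y, G (shuffle k sdeg x y) = 0)

include hG

lemma map_tWord_add (p q : ℕ) :
    (p + 1 : k) • G (word k (tWord (p + 1) q)) +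
      (q + 1 : k) • G (word k (tWord p (q + 1))) = 0 := by
  have h_shuffle := hG (word k [.dt]) (word k (tWord p q))
  rwa [shuffle_word (by simp) (by simp [tWord]), shuffleWord_dt_tWord, map_add, map_smul,
    map_smul] at h_shuffle

variable [CharZero k]

lemma map_replicate_dt_eq_zero (n : ℕ) : G (word k (List.replicate (n + 2) .dt)) = 0 := by
  have h_shuffle := hG (word k [.dt]) (word k (List.replicate (n + 1) .dt))
  rw [shuffle_word (by simp) (by simp), shuffleWord_dt_replicate, map_smul] at h_shuffle
  exact (smul_eq_zero.1 h_shuffle).resolve_left (Nat.cast_add_one_ne_zero _)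

lemma map_tWord_eq_zero {m : ℕ} (h_eq : G (word k (tWord 0 (m + 1))) = G (word k (tWord 1 m)))
    (p q : ℕ) (hpq : p + q = m + 1) : G (word k (tWord p q)) = 0 := by
  induction p generalizing q with
  | zero =>
    obtain rfl : q = m + 1 := by omega
    have h_add := map_tWord_add hG 0 m
    rw [zero_add, ← h_eq, ← add_smul] at h_add
    refine (smul_eq_zero.1 h_add).resolve_left ?_
    exact_mod_cast (by omega : 0 + 1 + (m + 1) ≠ 0)
  | succ p ih =>
    have h_add := map_tWord_add hG p q
    rw [ih (q + 1) (by omega), smul_zero, add_zero] at h_add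
    exact (smul_eq_zero.1 h_add).resolve_left (Nat.cast_add_one_ne_zero _)

end shuffles

lemma taylor_replicate_dt (n : ℕ) : taylor k (List.replicate n .dt) = 0 := by
  rcases n with _ | _ | _ | n
  · rfl
  · rfl
  · simp [taylor, List.replicate]
  · rw [List.replicate_succ, List.replicate_succ, List.replicate_succ, taylor_cons_cons_cons,
      if_neg]
    simp [List.count_replicate]

lemma coder_replicate_dt (n : ℕ) : coder sdeg (taylor k) (word k (List.replicate n .dt)) = 0 := by
  induction n with
  | zero => simp [word_nil]
  | succ n ih =>
    rw [List.replicate_succ, coder_word_cons, ih, map_zero, smul_zero, add_zero]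
    refine Finset.sum_eq_zero fun l _ => ?_
    rw [← List.replicate_succ, List.take_replicate, taylor_replicate_dt]
    rfl

lemma map_coder_t_t {M : Type*} [AddCommGroup M] [Module k M] {G : T k Letter →ₗ[k] M} {m : ℕ}
    (hG : ∀ v : List Letter, v.length < m + 2 → G (word k v) = 0) :
    G (coder sdeg (taylor k) (word k (.t :: tWord 0 m))) =
      G (word k (tWord 0 (m + 1))) - G (word k (tWord 1 m)) := by
  have h_taylor (f : Letter → M) : ((taylor k [.t]).sum fun j c => c • f j) = -f .dt := by
    rw [taylor, ← Finsupp.single_neg, Finsupp.sum_single_index (by exact zero_smul k _),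
      neg_one_smul]
  have h_cons (v : List Letter) (hv : v.length ≤ m) : (G ∘ₗ cons k .t) (word k v) = 0 := by
    by_cases h_nil : v = []
    · rw [h_nil, word_nil, map_zero]
    · rw [LinearMap.comp_apply, cons_word h_nil, hG _ (by simp only [List.length_cons]; omega)]
  have h_tail := map_coder_word_cons (deg := sdeg) (m := taylor k) (a := .t)
    (G := G ∘ₗ cons k .t) (w := List.replicate m .dt) fun v hv => h_cons v (by simpa using hv)
  rw [map_coder_word_cons fun v hv => hG v (by rw [length_tWord] at hv; omega)]
  change _ + _ • (G ∘ₗ cons k .t) (coder sdeg (taylor k) (word k (.t :: List.replicate m .dt))) = _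
  rw [h_tail, coder_replicate_dt, h_taylor fun j => G (word k (j :: tWord 0 m)),
    h_taylor fun j => (G ∘ₗ cons k .t) (word k (j :: List.replicate m .dt)),
    LinearMap.comp_apply, cons_word (by simp), sdeg, sgn_neg_one, map_zero, map_zero, smul_zero,
    add_zero, neg_one_smul, neg_neg, neg_add_eq_sub]
  rfl

lemma wdeg_eq_neg_count_t {w : List Letter} (h_one : Letter.one ∉ w) :
    wdeg sdeg w = -(w.count .t : ℤ) := by
  induction w with
  | nil => rfl
  | cons a w ih =>
    rw [List.mem_cons, not_or] at h_one
    rw [wdeg_cons, ih h_one.2]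
    cases a with
    | one => exact absurd rfl h_one.1
    | t => rw [List.count_cons_self]; simp [sdeg]
    | dt => rw [List.count_cons_of_ne (by simp)]; simp [sdeg]

section ext

variable {F F' : Module.End k (T k Letter)}
  (hF : IsUnitalCInf sdeg (taylor k) Letter.one F)
  (hF' : IsUnitalCInf sdeg (taylor k) Letter.one F')

include hF

lemma proj_apply_word_eq_zero {w : List Letter} (h_one : Letter.one ∉ w)
    (h_count : 2 ≤ w.count .t) : proj k Letter (F (word k w)) = 0 := by
  ext j
  by_contra h_ne
  rw [proj_apply] at h_ne
  have hw : w ≠ [] := by rintro rfl; simp at h_count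
  have h_deg := hF.degree ⟨w, hw⟩ ⟨[j], by simp⟩ h_ne
  rw [wdeg_eq_neg_count_t h_one, wdeg_cons, wdeg_nil] at h_deg
  cases j <;> simp only [sdeg] at h_deg <;> omega

include hF'

variable [CharZero k]

lemma proj_apply_word_eq {w : List Letter} (hw : 2 ≤ w.length)
    (h_short : ∀ v : List Letter, v.length < w.length → F (word k v) = F' (word k v)) :
    proj k Letter (F (word k w)) = proj k Letter (F' (word k w)) := by
  by_cases h_one : Letter.one ∈ w
  · rw [hF.unit_zero w hw h_one, hF'.unit_zero w hw h_one]
  let G := proj k Letter ∘ₗ (F - F')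
  have hG (x y : T k Letter) : G (shuffle k sdeg x y) = 0 := by
    simp only [G, LinearMap.comp_apply, LinearMap.sub_apply, hF.shuffle, hF'.shuffle, map_sub,
      proj_shuffle, sub_zero]
  suffices G (word k w) = 0 by
    rwa [LinearMap.comp_apply, LinearMap.sub_apply, map_sub, sub_eq_zero] at this
  obtain ⟨m, hm⟩ := Nat.exists_eq_add_of_le' hw
  obtain h_count | h_count | h_count :
      w.count .t = 0 ∨ w.count .t = 1 ∨ 2 ≤ w.count .t := by omega
  · rw [eq_replicate_dt h_one h_count, hm]
    exact map_replicate_dt_eq_zero hG m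
  · obtain ⟨p, q, rfl⟩ := exists_eq_tWord h_one h_count
    rw [length_tWord] at hm h_short
    have hG_short (v : List Letter) (hv : v.length < m + 2) : G (word k v) = 0 := by
      simp only [G, LinearMap.comp_apply, LinearMap.sub_apply, h_short v (by omega), sub_self,
        map_zero]
    have h_tt : F (word k (.t :: tWord 0 m)) = F' (word k (.t :: tWord 0 m)) := by
      refine apply_word_eq_of_proj_eq hF.comul hF'.comul
        (fun v hv => h_short v (by simp only [List.length_cons, length_tWord] at hv; omega)) ?_
      rw [proj_apply_word_eq_zero hF (by simp [tWord]) (by simp [tWord]),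
        proj_apply_word_eq_zero hF' (by simp [tWord]) (by simp [tWord])]
    refine map_tWord_eq_zero hG (m := m) (sub_eq_zero.1 ?_) p q (by omega)
    rw [← map_coder_t_t hG_short, LinearMap.comp_apply, LinearMap.sub_apply, hF.coder, hF'.coder,
      h_tt, sub_self, map_zero]
  · simp only [G, LinearMap.comp_apply, LinearMap.sub_apply, map_sub,
      proj_apply_word_eq_zero hF h_one h_count, proj_apply_word_eq_zero hF' h_one h_count,
      sub_self]

lemma isUnitalCInf_ext
    (h_linear : ∀ j, proj k Letter (F (word k [j])) = proj k Letter (F' (word k [j]))) :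
    F = F' := by
  refine hom_ext fun w _ => ?_
  induction h_length : w.length using Nat.strong_induction_on generalizing w with
  | h n ih =>
    have h_short (v : List Letter) (hv : v.length < w.length) : F (word k v) = F' (word k v) := by
      by_cases h_nil : v = []
      · rw [h_nil, word_nil, map_zero, map_zero]
      · exact ih _ (h_length ▸ hv) v h_nil rfl
    refine apply_word_eq_of_proj_eq hF.comul hF'.comul h_short ?_
    rcases w with _ | ⟨a, _ | ⟨b, w⟩⟩
    · simp only [word_nil, map_zero]
    · exact h_linear a
    · exact proj_apply_word_eq hF hF' (by simp) h_short

end ext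

end Whitney

/-! ### Endomorphisms of the complex of Whitney forms -/

namespace Whitney

variable {k : Type*} [Field k]

lemma basis_apply (j : Letter) : basis k j = letter k j := Module.Basis.mk_apply _ _ _

lemma repr_letter (j : Letter) : (basis k).repr (letter k j) = Finsupp.single j 1 := by
  rw [← basis_apply, Module.Basis.repr_self]

lemma repr_symm_single (j : Letter) (c : k) :
    (basis k).repr.symm (Finsupp.single j c) = c • letter k j := by
  rw [Module.Basis.repr_symm_single, basis_apply]

lemma end_ext {ξ η : Module.End k (forms k)} (h : ∀ j, ξ (letter k j) = η (letter k j)) : ξ = η :=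
  (basis k).ext fun j => by rw [basis_apply, h]

lemma forms_eq_sum (f : forms k) : f = (basis k).repr f .one • letter k .one +
    ((basis k).repr f .t • letter k .t + (basis k).repr f .dt • letter k .dt) := by
  conv_lhs => rw [← (basis k).sum_repr f, sum_letter]
  simp only [basis_apply]

lemma forms_fst (f : forms k) :
    (f : PolyForm k).1 = C ((basis k).repr f .one) + C ((basis k).repr f .t) * X := by
  conv_lhs => rw [forms_eq_sum f]
  simp [letter, letterForm, smul_eq_C_mul]

lemma forms_snd (f : forms k) : (f : PolyForm k).2 = C ((basis k).repr f .dt) := by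
  conv_lhs => rw [forms_eq_sum f]
  simp [letter, letterForm, smul_eq_C_mul]

lemma mem_forms0 {f : forms k} : f ∈ forms0 k ↔ (basis k).repr f .dt = 0 := by
  rw [← C_eq_zero (R := k), ← forms_snd]
  rfl

lemma mem_forms1 {f : forms k} :
    f ∈ forms1 k ↔ (basis k).repr f .one = 0 ∧ (basis k).repr f .t = 0 := by
  change (f : PolyForm k).1 = 0 ↔ _
  rw [forms_fst]
  refine ⟨fun h => ?_, fun ⟨h_one, h_t⟩ => by rw [h_one, h_t, C_0, zero_mul, add_zero]⟩
  exact ⟨by simpa using congrArg (coeff · 0) h, by simpa using congrArg (coeff · 1) h⟩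

lemma d_one : d k (letter k .one) = 0 :=
  Subtype.ext <| by simp [d, polyD, letter, letterForm]

lemma d_t : d k (letter k .t) = letter k .dt :=
  Subtype.ext <| by simp [d, polyD, letter, letterForm]

lemma d_dt : d k (letter k .dt) = 0 :=
  Subtype.ext <| by simp [d, polyD, letter, letterForm]

lemma repr_d (f : forms k) : (basis k).repr (d k f) =
    -Finsupp.linearCombination k (fun j => taylor k [j]) ((basis k).repr f) := by
  suffices (basis k).repr.toLinearMap ∘ₗ d k =
      -(Finsupp.linearCombination k (fun j => taylor k [j]) ∘ₗ (basis k).repr.toLinearMap) from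
    LinearMap.congr_fun this f
  refine (basis k).ext fun j => ?_
  cases j <;> simp [basis_apply, repr_letter, d_one, d_t, d_dt, taylor]

lemma affineMap_apply (A : k →ᵃ[k] k) (x : k) : A x = (A 1 - A 0) * x + A 0 := by
  have h_line := A.apply_lineMap 0 1 x
  rwa [AffineMap.lineMap_apply_ring', AffineMap.lineMap_apply_ring', sub_zero, mul_one, add_zero,
    mul_comm x] at h_line

/-- The pullback of Whitney forms along an affine map of the line. -/
def pullback (A : k →ᵃ[k] k) : Module.End k (forms k) :=
  (basis k).constr k fun
    | .one => letter k .one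
    | .t => (A 1 - A 0) • letter k .t + A 0 • letter k .one
    | .dt => (A 1 - A 0) • letter k .dt

lemma pullback_one (A : k →ᵃ[k] k) : pullback A (letter k .one) = letter k .one := by
  rw [← basis_apply, pullback, Module.Basis.constr_basis, basis_apply]

lemma pullback_t (A : k →ᵃ[k] k) :
    pullback A (letter k .t) = (A 1 - A 0) • letter k .t + A 0 • letter k .one := by
  rw [← basis_apply, pullback, Module.Basis.constr_basis, basis_apply]

lemma pullback_dt (A : k →ᵃ[k] k) :
    pullback A (letter k .dt) = (A 1 - A 0) • letter k .dt := by
  rw [← basis_apply, pullback, Module.Basis.constr_basis, basis_apply]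

lemma repr_pullback (A : k →ᵃ[k] k) (f : forms k) : (basis k).repr (pullback A f) =
    Finsupp.single .one ((basis k).repr f .one + A 0 * (basis k).repr f .t) +
      Finsupp.single .t ((A 1 - A 0) * (basis k).repr f .t) +
        Finsupp.single .dt ((A 1 - A 0) * (basis k).repr f .dt) := by
  conv_lhs => rw [forms_eq_sum f]
  simp only [map_add, map_smul, pullback_one, pullback_t, pullback_dt, repr_letter]
  ext j
  cases j <;> simp [mul_comm]

lemma pullback_id : pullback (1 : k →ᵃ[k] k) = 1 :=
  end_ext fun j => by cases j <;> simp [pullback_one, pullback_t, pullback_dt]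

lemma pullback_mul (A B : k →ᵃ[k] k) : pullback (A * B) = pullback B * pullback A := by
  refine end_ext fun j => ?_
  have h_zero : (A * B) 0 = (A 1 - A 0) * B 0 + A 0 := affineMap_apply A (B 0)
  have h_slope : (A * B) 1 - (A * B) 0 = (A 1 - A 0) * (B 1 - B 0) := by
    change A (B 1) - A (B 0) = _
    rw [affineMap_apply A (B 1), affineMap_apply A (B 0)]
    ring
  rw [Module.End.mul_apply]
  cases j with
  | one => rw [pullback_one, pullback_one, pullback_one]
  | t =>
    rw [pullback_t, pullback_t, map_add, map_smul, map_smul, pullback_t, pullback_one, h_slope,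
      h_zero]
    module
  | dt => rw [pullback_dt, pullback_dt, map_smul, pullback_dt, h_slope, mul_smul]

lemma eval_pullback (A : k →ᵃ[k] k) (f : forms k) (x : k) :
    eval x (pullback A f : PolyForm k).1 = eval (A x) (f : PolyForm k).1 := by
  rw [forms_fst, forms_fst, repr_pullback, affineMap_apply A x]
  simp only [Finsupp.add_apply, Finsupp.single_apply, eval_add, eval_mul, eval_C, eval_X,
    reduceCtorEq, if_true, if_false, add_zero, zero_add]
  ring

lemma pullback_mem_chainEnd (A : k →ᵃ[k] k) : pullback A ∈ chainEnd k := by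
  refine ⟨fun f hf => ?_, fun f hf => ?_, fun f => ?_, pullback_one A⟩
  · rw [mem_forms0] at hf ⊢
    simp [repr_pullback, hf]
  · rw [mem_forms1] at hf ⊢
    simp [repr_pullback, hf]
  · suffices d k ∘ₗ pullback A = pullback A ∘ₗ d k from LinearMap.congr_fun this f
    refine end_ext fun j => ?_
    cases j <;> simp [pullback_one, pullback_t, pullback_dt, d_one, d_t, d_dt]

lemma chainEnd_ext {ξ η : Module.End k (forms k)} (hξ : ξ ∈ chainEnd k) (hη : η ∈ chainEnd k)
    (ht : ξ (letter k .t) = η (letter k .t)) : ξ = η := by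
  refine end_ext fun j => ?_
  cases j with
  | one => rw [hξ.2.2.2, hη.2.2.2]
  | t => exact ht
  | dt => rw [← d_t, ← hξ.2.2.1, ← hη.2.2.1, ht]

lemma exists_eq_pullback {ξ : Module.End k (forms k)} (hξ : ξ ∈ chainEnd k) :
    ∃ A : k →ᵃ[k] k, ξ = pullback A := by
  have ht : (basis k).repr (ξ (letter k .t)) .dt = 0 :=
    mem_forms0.1 (hξ.1 _ (mem_forms0.2 (by simp [repr_letter])))
  obtain ⟨a, b, hab⟩ : ∃ a b : k, ξ (letter k .t) = a • letter k .t + b • letter k .one := by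
    have h_sum := forms_eq_sum (ξ (letter k .t))
    rw [ht, zero_smul, add_zero, add_comm] at h_sum
    exact ⟨_, _, h_sum⟩
  refine ⟨AffineMap.lineMap b (a + b), chainEnd_ext hξ (pullback_mem_chainEnd _) ?_⟩
  rw [hab, pullback_t, AffineMap.lineMap_apply_zero, AffineMap.lineMap_apply_one,
    add_sub_cancel_right]

lemma pullback_injective : Function.Injective (pullback (k := k)) := by
  intro A B hAB
  have h_repr := congrArg (fun ξ => (basis k).repr (ξ (letter k .t))) hAB
  simp only [repr_pullback, repr_letter] at h_repr
  have h_zero : A 0 = B 0 := by simpa using DFunLike.congr_fun h_repr Letter.one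
  have h_slope : A 1 - A 0 = B 1 - B 0 := by simpa using DFunLike.congr_fun h_repr Letter.t
  ext x
  rw [affineMap_apply A, affineMap_apply B, h_slope, h_zero]

variable (k) in
/-- Pullback as a homomorphism of monoids. -/
def pullbackHom : (k →ᵃ[k] k)ᵐᵒᵖ →* chainEnd k where
  toFun A := ⟨pullback A.unop, pullback_mem_chainEnd _⟩
  map_one' := Subtype.ext pullback_id
  map_mul' A B := Subtype.ext (pullback_mul B.unop A.unop)

lemma pullbackHom_bijective : Function.Bijective (pullbackHom k) :=
  ⟨fun _ _ h => MulOpposite.unop_injective (pullback_injective (congrArg Subtype.val h)),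
    fun ξ => (exists_eq_pullback ξ.2).imp' MulOpposite.op fun _ h => Subtype.ext h.symm⟩

variable (k) in
/-- The monoid of endomorphisms of the complex of Whitney forms is opposite to that of affine
maps of the line, by pullback. -/
def pullbackEquiv : (k →ᵃ[k] k)ᵐᵒᵖ ≃* chainEnd k :=
  MulEquiv.ofBijective (pullbackHom k) pullbackHom_bijective

variable (k) in
/-- The group of automorphisms of the complex of Whitney forms is the affine group, an affine
bijection acting by pullback along its inverse. -/
def chainAutEquiv : ChainAut k ≃* (k ≃ᵃ[k] k) :=
  (Units.mapEquiv (pullbackEquiv k).symm).trans <| Units.opEquiv.trans <|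
    (MulEquiv.inv' _).symm.trans AffineEquiv.equivUnitsAffineMap.symm

lemma eval_chainAutEquiv (ξ : ChainAut k) (f : forms k) (x : k) :
    eval (chainAutEquiv k ξ x) ((ξ : chainEnd k).1 f : PolyForm k).1 =
      eval x (f : PolyForm k).1 := by
  obtain ⟨A, rfl⟩ := (chainAutEquiv k).symm.surjective ξ
  have h_symm : (((chainAutEquiv k).symm A : chainEnd k) : Module.End k (forms k)) =
      pullback (A.symm : k →ᵃ[k] k) := rfl
  rw [MulEquiv.apply_symm_apply, h_symm, eval_pullback]
  exact congrArg (eval · _) (A.symm_apply_apply x)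

/-! ### The affine group as a semidirect product -/

lemma slope_ne_zero (A : k ≃ᵃ[k] k) : A 1 - A 0 ≠ 0 :=
  sub_ne_zero.2 (A.injective.ne one_ne_zero)

lemma affineEquiv_apply (A : k ≃ᵃ[k] k) (x : k) : A x = (A 1 - A 0) * x + A 0 :=
  affineMap_apply (A : k →ᵃ[k] k) x

variable (k) in
/-- The affine bijection `x ↦ α x + β` as the element `(α, β)` of the semidirect product. -/
def affineEquivHom : (k ≃ᵃ[k] k) →* Multiplicative k ⋊[scaling k] kˣ :=
  MonoidHom.mk' (fun A => ⟨Multiplicative.ofAdd (A 0), Units.mk0 (A 1 - A 0) (slope_ne_zero A)⟩)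
    fun A B => by
      refine SemidirectProduct.ext ?_ (Units.ext ?_)
      · change A (B 0) = A 0 + (A 1 - A 0) * B 0
        rw [affineEquiv_apply A (B 0), add_comm]
      · change A (B 1) - A (B 0) = (A 1 - A 0) * (B 1 - B 0)
        rw [affineEquiv_apply A (B 0), affineEquiv_apply A (B 1)]
        ring

lemma affineEquivHom_bijective : Function.Bijective (affineEquivHom k) := by
  constructor
  · intro A B hAB
    have h_zero : A 0 = B 0 := congrArg (fun p => Multiplicative.toAdd p.left) hAB
    have h_slope : A 1 - A 0 = B 1 - B 0 := congrArg (fun p => (p.right : k)) hAB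
    ext x
    rw [affineEquiv_apply A, affineEquiv_apply B, h_slope, h_zero]
  · rintro ⟨β, α⟩
    refine ⟨(DistribMulAction.toLinearEquiv k k α).toAffineEquiv.trans
      (AffineEquiv.constVAdd k k (Multiplicative.toAdd β)), ?_⟩
    refine SemidirectProduct.ext ?_ (Units.ext ?_)
    · change Multiplicative.toAdd β + α • (0 : k) = Multiplicative.toAdd β
      rw [smul_zero, add_zero]
    · change Multiplicative.toAdd β + α • (1 : k) - (Multiplicative.toAdd β + α • (0 : k)) = α
      rw [smul_zero, add_zero, add_sub_cancel_left, Units.smul_def, smul_eq_mul, mul_one]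

variable (k) in
/-- The affine group as the semidirect product of the scalings and the translations. -/
def affineEquivSemidirect : (k ≃ᵃ[k] k) ≃* Multiplicative k ⋊[scaling k] kˣ :=
  MulEquiv.ofBijective (affineEquivHom k) affineEquivHom_bijective

lemma affineEquivSemidirect_apply (A : k ≃ᵃ[k] k) (x : k) :
    A x = ((affineEquivSemidirect k A).right : k) * x +
      Multiplicative.toAdd (affineEquivSemidirect k A).left :=
  affineEquiv_apply A x

end Whitney

/-! ### The linear part of a morphism -/

namespace TBar

variable {k ι : Type*} [Field k] {deg : ι → ℤ} {m : List ι → (ι →₀ k)}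

lemma incl_single (j : ι) (c : k) : incl k ι (Finsupp.single j c) = c • word k [j] := by
  rw [incl, Finsupp.linearCombination_single]

lemma proj_word_singleton (j : ι) : proj k ι (word k [j]) = Finsupp.single j 1 :=
  lift_word _ (by simp)

lemma incl_apply_cons_cons (v : ι →₀ k) (i j : ι) (w : List ι) :
    incl k ι v ⟨i :: j :: w, by simp⟩ = 0 := by
  induction v using Finsupp.induction_linear with
  | zero => rw [map_zero, Finsupp.zero_apply]
  | add x y hx hy => rw [map_add, Finsupp.add_apply, hx, hy, add_zero]
  | single l c =>
    rw [incl_single, word_eq ⟨[l], by simp⟩]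
    simp

lemma proj_incl (v : ι →₀ k) : proj k ι (incl k ι v) = v := by
  induction v using Finsupp.induction_linear with
  | zero => rw [map_zero, map_zero]
  | add x y hx hy => rw [map_add, map_add, hx, hy]
  | single j c => rw [incl_single, map_smul, proj_word_singleton, Finsupp.smul_single_one]

lemma comul_incl (v : ι →₀ k) : comul k ι (incl k ι v) = 0 := by
  induction v using Finsupp.induction_linear with
  | zero => rw [map_zero, map_zero]
  | add x y hx hy => rw [map_add, map_add, hx, hy, add_zero]
  | single j c =>
    rw [incl_single, map_smul, comul, lift_word _ (by simp)]
    simp [word_nil]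

lemma incl_proj_of_comul_eq_zero {x : T k ι} (hx : comul k ι x = 0) :
    incl k ι (proj k ι x) = x := by
  ext ⟨w, hw⟩
  rcases w with _ | ⟨i, _ | ⟨j, w⟩⟩
  · exact absurd rfl hw
  · rw [← proj_apply, proj_incl, proj_apply]
  · rw [incl_apply_cons_cons, ← coeff_comul i ⟨j :: w, by simp⟩, hx, map_zero, map_zero]

lemma coder_incl (v : ι →₀ k) :
    coder deg m (incl k ι v) = incl k ι (Finsupp.linearCombination k (fun j => m [j]) v) := by
  induction v using Finsupp.induction_linear with
  | zero => simp only [map_zero]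
  | add x y hx hy => simp only [map_add, hx, hy]
  | single j c =>
    rw [incl_single, map_smul, coder_word_cons, Finsupp.linearCombination_single, map_smul]
    simp [word_nil, incl, Finsupp.linearCombination_apply]

namespace IsUnitalCInf

variable {e : ι} {F : Module.End k (T k ι)} (hF : IsUnitalCInf deg m e F)

include hF

lemma incl_proj_apply_incl (v : ι →₀ k) :
    incl k ι (proj k ι (F (incl k ι v))) = F (incl k ι v) :=
  incl_proj_of_comul_eq_zero (by rw [hF.comul, comul_incl, map_zero])

lemma proj_apply_incl_linearCombination (v : ι →₀ k) :
    proj k ι (F (incl k ι (Finsupp.linearCombination k (fun j => m [j]) v))) =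
      Finsupp.linearCombination k (fun j => m [j]) (proj k ι (F (incl k ι v))) := by
  rw [← coder_incl (deg := deg), hF.coder, ← hF.incl_proj_apply_incl, coder_incl, proj_incl,
    proj_incl]

lemma proj_apply_singleton_eq_zero {i j : ι} (hij : deg i ≠ deg j) :
    proj k ι (F (word k [i])) j = 0 := by
  rw [proj_apply]
  by_contra h_ne
  have h_deg := hF.degree ⟨[i], by simp⟩ ⟨[j], by simp⟩ h_ne
  rw [wdeg_cons, wdeg_cons, wdeg_nil, add_zero, add_zero] at h_deg
  exact hij h_deg.symm

end IsUnitalCInf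

end TBar

namespace Whitney

open TBar

variable {k : Type*} [Field k]

lemma repr_linearPart (F : Module.End k (T k Letter)) (f : forms k) :
    (basis k).repr (linearPart F f) = proj k Letter (F (incl k Letter ((basis k).repr f))) :=
  (basis k).repr.apply_symm_apply _

lemma repr_linearPart_letter (F : Module.End k (T k Letter)) (j : Letter) :
    (basis k).repr (linearPart F (letter k j)) = proj k Letter (F (word k [j])) := by
  rw [repr_linearPart, repr_letter, incl_single, one_smul]

lemma linearPart_one : linearPart (1 : Module.End k (T k Letter)) = 1 :=
  LinearMap.ext fun f => (basis k).repr.injective <| by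
    rw [repr_linearPart, Module.End.one_apply, Module.End.one_apply, proj_incl]

lemma linearPart_mul (G : Module.End k (T k Letter)) {F : Module.End k (T k Letter)}
    {m : List Letter → (Letter →₀ k)} (hF : IsUnitalCInf sdeg m Letter.one F) :
    linearPart (G * F) = linearPart G * linearPart F :=
  LinearMap.ext fun f => (basis k).repr.injective <| by
    rw [Module.End.mul_apply, repr_linearPart, repr_linearPart, repr_linearPart,
      hF.incl_proj_apply_incl, Module.End.mul_apply]

section

variable {F : Module.End k (T k Letter)} (hF : IsUnitalCInf sdeg (taylor k) Letter.one F)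

include hF

lemma linearPart_apply_one : linearPart F (letter k .one) = letter k .one :=
  (basis k).repr.injective <| by rw [repr_linearPart_letter, hF.unit_one, repr_letter]

lemma linearPart_mem_forms0 {f : forms k} (hf : f ∈ forms0 k) : linearPart F f ∈ forms0 k := by
  rw [mem_forms0] at hf ⊢
  rw [forms_eq_sum f, hf, zero_smul, add_zero, map_add, map_smul, map_smul, map_add, map_smul,
    map_smul, repr_linearPart_letter, repr_linearPart_letter, Finsupp.add_apply,
    Finsupp.smul_apply, Finsupp.smul_apply, hF.proj_apply_singleton_eq_zero (by simp [sdeg]),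
    hF.proj_apply_singleton_eq_zero (by simp [sdeg]), smul_zero, smul_zero, add_zero]

lemma linearPart_mem_forms1 {f : forms k} (hf : f ∈ forms1 k) : linearPart F f ∈ forms1 k := by
  rw [mem_forms1] at hf ⊢
  rw [forms_eq_sum f, hf.1, hf.2, zero_smul, zero_smul, zero_add, zero_add, map_smul, map_smul,
    repr_linearPart_letter, Finsupp.smul_apply, Finsupp.smul_apply,
    hF.proj_apply_singleton_eq_zero (by simp [sdeg]),
    hF.proj_apply_singleton_eq_zero (by simp [sdeg]), smul_zero]
  exact ⟨rfl, rfl⟩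

lemma d_linearPart (f : forms k) : d k (linearPart F f) = linearPart F (d k f) := by
  refine (basis k).repr.injective ?_
  rw [repr_linearPart, repr_d, repr_d, map_neg, map_neg, map_neg,
    hF.proj_apply_incl_linearCombination, repr_linearPart]

lemma linearPart_mem_chainEnd : linearPart F ∈ chainEnd k :=
  ⟨fun _ => linearPart_mem_forms0 hF, fun _ => linearPart_mem_forms1 hF, d_linearPart hF,
    linearPart_apply_one hF⟩

end

lemma linearPart_affineMorphism [CharZero k] (A : k →ᵃ[k] k) :
    linearPart (affineMorphism k (A 0) (A 1)) = pullback A := by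
  refine chainEnd_ext (linearPart_mem_chainEnd (affineMorphism_isUnitalCInf _ _))
    (pullback_mem_chainEnd A) ((basis k).repr.injective ?_)
  rw [repr_linearPart_letter, proj_affineMorphism_t, pullback_t, map_add, map_smul, map_smul,
    repr_letter, repr_letter, Finsupp.smul_single_one, Finsupp.smul_single_one]

variable (k) in
/-- The linear part as a homomorphism of monoids. -/
def linearPartHom : unitalCInfEnd sdeg (taylor k) Letter.one →* chainEnd k where
  toFun F := ⟨linearPart F.1, linearPart_mem_chainEnd F.2⟩
  map_one' := Subtype.ext linearPart_one
  map_mul' G F := Subtype.ext (linearPart_mul G.1 F.2)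

lemma linearPartHom_bijective [CharZero k] : Function.Bijective (linearPartHom k) := by
  constructor
  · intro F F' h
    have h_linear : linearPart F.1 = linearPart F'.1 := congrArg Subtype.val h
    refine Subtype.ext (isUnitalCInf_ext F.2 F'.2 fun j => ?_)
    rw [← repr_linearPart_letter, h_linear, repr_linearPart_letter]
  · rintro ⟨ξ, hξ⟩
    obtain ⟨A, rfl⟩ := exists_eq_pullback hξ
    exact ⟨⟨affineMorphism k (A 0) (A 1), affineMorphism_isUnitalCInf (A 0) (A 1)⟩,
      Subtype.ext (linearPart_affineMorphism A)⟩

variable (k) in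
/-- The linear part as an isomorphism of automorphism groups. -/
def linearPartEquiv [CharZero k] : AutInf k ≃* ChainAut k :=
  Units.mapEquiv (MulEquiv.ofBijective (linearPartHom k) linearPartHom_bijective)

end Whitney

end

/-- Taking the linear part is an isomorphism from the group of unital `C∞` automorphisms of the
Whitney forms onto the group of automorphisms of the complex of Whitney forms that fix `1`, which
is the affine group of `k` (by `f ↦ f ∘ A⁻¹` on degree zero forms), which in turn is `kˣ ⋉ k`. -/
theorem mainTheorem8 (k : Type*) [Field k] [CharZero k] :
    (∃ r : Whitney.AutInf k ≃* Whitney.ChainAut k,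
      ∀ ψ : Whitney.AutInf k,
        (((r ψ : Whitney.chainEnd k)) : Module.End k (Whitney.forms k)) =
          Whitney.linearPart
            ((ψ : TBar.unitalCInfEnd Whitney.sdeg (Whitney.taylor k) Whitney.Letter.one) :
              Module.End k (TBar.T k Whitney.Letter))) ∧
    (∃ e : Whitney.ChainAut k ≃* (k ≃ᵃ[k] k),
      ∀ (ξ : Whitney.ChainAut k) (f : Whitney.forms k) (x : k),
        Polynomial.eval (e ξ x)
            ((((ξ : Whitney.chainEnd k) : Module.End k (Whitney.forms k)) f : Whitney.forms k) :
              Whitney.PolyForm k).1 =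
          Polynomial.eval x (f : Whitney.PolyForm k).1) ∧
    (∃ e' : (k ≃ᵃ[k] k) ≃* Multiplicative k ⋊[Whitney.scaling k] kˣ,
      ∀ (A : k ≃ᵃ[k] k) (x : k),
        A x = ((e' A).right : k) * x + Multiplicative.toAdd (e' A).left) := by
  exact ⟨⟨Whitney.linearPartEquiv k, fun _ => rfl⟩,
    ⟨Whitney.chainAutEquiv k, Whitney.eval_chainAutEquiv⟩,
    ⟨Whitney.affineEquivSemidirect k, Whitney.affineEquivSemidirect_apply⟩⟩
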